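/- For every integer $m \ge 4$ there is a triangulation $L$ of $S^2$ with $m$ vertices that cannot appear as the link of a vertex in a $3$-well-centered mesh, that is, in a simplicial complex in $\mathbb{R}^3$ each of whose tetrahedra contains its circumcenter in its interior. More precisely, for every $m \ge 4$ there is a finite abstract simplicial complex $K$ such that $L = \partial K$ (the complex formed by the triangles of $K$ lying in exactly one tetrahedron of $K$, and their faces) is such a triangulation, where $K$ is as follows. If $m = 4$, then $K$ is a single tetrahedron with its faces. If $m \ge 5$, then $K$ consists of $m-2$ tetrahedra closing around a common edge, i.e. of the tetrahedra $[a\,b\,c_i\,c_{i+1}]$, $i \in \mathbb{Z}/(m-2)$, with distinct vertices $a, b, c_0, \dots, c_{m-3}$, and of their faces; in this case $L$ has degree list $(m-2, m-2, 4, \dots, 4)$ with $m-2$ entries $4$. In all cases $K$ certifies $L$ through the One-Ring condition: $K$ is a $3$-dimensional manifold complex with boundary, $\partial K$ is isomorphic to $L$, and every tetrahedron of $K$ has at least two of its triangular facets in $L$. -/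

import Mathlib

/-! ### Finite abstract simplicial complexes -/

namespace PreAbstractSimplicialComplex

/-- The vertex set of an abstract simplicial complex. -/
def vertexSet {V : Type*} (K : PreAbstractSimplicialComplex V) : Set V :=
  {v | {v} ∈ K.faces}

/-- The geometric realization (underlying space) `|K|` of a complex on a finite vertex type:
points with nonnegative barycentric coordinates of sum `1` whose support is contained in a face,
with the topology inherited from `V → ℝ`. -/
def realization {V : Type*} [Fintype V] (K : PreAbstractSimplicialComplex V) : Set (V → ℝ) :=
  {x | (∀ v, 0 ≤ x v) ∧ ∑ v, x v = 1 ∧ ∃ s ∈ K.faces, ∀ v, v ∉ s → x v = 0}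

/-- `K` is a triangulation of the sphere `S²`. -/
def IsTriangulationOfS2 {V : Type*} [Fintype V] (K : PreAbstractSimplicialComplex V) : Prop :=
  Nonempty (K.realization ≃ₜ Metric.sphere (0 : EuclideanSpace ℝ (Fin 3)) 1)

/-- `K` is a `3`-manifold complex with boundary: every point of `|K|` has an open neighbourhood
homeomorphic to an open subset of the closed half-space of dimension `3`. (The Hausdorff and
second countability axioms hold automatically, `|K|` being a subset of `V → ℝ`.) -/
def IsThreeManifoldComplex {V : Type*} [Fintype V] (K : PreAbstractSimplicialComplex V) : Prop :=
  Nonempty (ChartedSpace (EuclideanHalfSpace 3) K.realization)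

/-- `K` is `3`-dimensional: it has a tetrahedron and no simplex of larger dimension. -/
def IsThreeDimensional {V : Type*} (K : PreAbstractSimplicialComplex V) : Prop :=
  (∃ s ∈ K.faces, s.card = 4) ∧ ∀ s ∈ K.faces, s.card ≤ 4

/-- The boundary `∂K` of a complex of dimension `3`: the complex formed by the triangles of `K`
that belong to exactly one tetrahedron of `K`, and the faces of these triangles. -/
def boundary {V : Type*} (K : PreAbstractSimplicialComplex V) : PreAbstractSimplicialComplex V where
  faces := {s | s.Nonempty ∧ ∃ t ∈ K.faces, s ⊆ t ∧ t.card = 3 ∧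
    ∃! σ : Finset V, σ ∈ K.faces ∧ σ.card = 4 ∧ t ⊆ σ}
  isRelLowerSet_faces := by
    rintro s ⟨hs, t, ht, hst, h⟩
    exact ⟨hs, fun s' hs' hne => ⟨hne, t, ht, hs'.trans hst, h⟩⟩

/-- Simplicial isomorphism of two complexes: a map of vertices, injective on the vertices of `K`,
under which the faces of `L` are exactly the images of the faces of `K`. -/
def IsIsomorphic {V W : Type*} (K : PreAbstractSimplicialComplex V)
    (L : PreAbstractSimplicialComplex W) : Prop :=
  ∃ f : V → W, Set.InjOn f K.vertexSet ∧
    ∀ t : Finset W, t ∈ L.faces ↔ ∃ s ∈ K.faces, (t : Set W) = f '' (s : Set V)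

/-- The degree of a vertex: the number of edges incident to it. -/
noncomputable def vertexDegree {V : Type*} (K : PreAbstractSimplicialComplex V) (v : V) : ℕ :=
  {e : Finset V | e ∈ K.faces ∧ e.card = 2 ∧ v ∈ e}.ncard

open Classical in
/-- The degree list: the multiset of the degrees of all the vertices. -/
noncomputable def degreeList {V : Type*} [Fintype V] (K : PreAbstractSimplicialComplex V) :
    Multiset ℕ :=
  (Finset.univ.filter (fun v => v ∈ K.vertexSet)).val.map K.vertexDegree

/-- `K` consists of a single tetrahedron and its faces. -/
def IsSingleTetrahedron {V : Type*} (K : PreAbstractSimplicialComplex V) : Prop :=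
  ∃ σ : Finset V, σ.card = 4 ∧ ∀ s : Finset V, s ∈ K.faces ↔ s.Nonempty ∧ s ⊆ σ

/-- `K` consists of `k` tetrahedra closing around a common edge, and of their faces: the common
edge is `ab`, and the tetrahedra are `a b c_i c_{i+1}`, where `i` runs through the integers
modulo `k` and `c_0, …, c_{k-1}` are pairwise distinct. -/
def IsTetrahedraAroundEdge {V : Type*} (K : PreAbstractSimplicialComplex V) (k : ℕ) : Prop :=
  3 ≤ k ∧ ∃ (a b : V) (c : ZMod k → V), a ≠ b ∧ Function.Injective c ∧
    (∀ i, c i ≠ a) ∧ (∀ i, c i ≠ b) ∧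
    ∀ s : Finset V, s ∈ K.faces ↔
      s.Nonempty ∧ ∃ i : ZMod k, (s : Set V) ⊆ {a, b, c i, c (i + 1)}

/-- `K` satisfies, for `L`, the One-Ring condition in dimension `3`: `K` is a `3`-dimensional
manifold complex with boundary, `∂K` is isomorphic to `L`, and every tetrahedron of `K` has at
least two of its triangles in `∂K`. -/
structure IsOneRingCertificate {V W : Type*} [Fintype V] (K : PreAbstractSimplicialComplex V)
    (L : PreAbstractSimplicialComplex W) : Prop where
  dimension : K.IsThreeDimensional
  manifold : K.IsThreeManifoldComplex
  boundary_iso : K.boundary.IsIsomorphic L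
  two_facets : ∀ σ ∈ K.faces, σ.card = 4 →
    2 ≤ {τ : Finset V | τ ∈ K.boundary.faces ∧ τ.card = 3 ∧ τ ⊆ σ}.ncard

end PreAbstractSimplicialComplex

/-! ### Meshes in `ℝ³` -/

/-- The link of `u` in a simplicial complex `M` in `ℝ³`: the simplices of the closed star of `u`
(that is, the faces of the simplices incident to `u`) that are not incident to `u`. -/
def vertexLink (M : Geometry.SimplicialComplex ℝ (EuclideanSpace ℝ (Fin 3)))
    (u : EuclideanSpace ℝ (Fin 3)) :
    PreAbstractSimplicialComplex (EuclideanSpace ℝ (Fin 3)) where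
  faces := {t | t.Nonempty ∧ u ∉ t ∧ ∃ s ∈ M.faces, u ∈ s ∧ t ⊆ s}
  isRelLowerSet_faces := by
    rintro t ⟨ht, hu, s, hs, hus, hts⟩
    exact ⟨ht, fun t' ht' hne => ⟨hne, fun h => hu (ht' h), s, hs, hus, ht'.trans hts⟩⟩

/-- A mesh in `ℝ³` is `3`-well-centered if every tetrahedron of the mesh contains its
circumcenter in its interior. -/
def IsThreeWellCentered (M : Geometry.SimplicialComplex ℝ (EuclideanSpace ℝ (Fin 3))) : Prop :=
  ∀ σ : Affine.Simplex ℝ (EuclideanSpace ℝ (Fin 3)) 3,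
    (∃ s ∈ M.faces, (s : Set (EuclideanSpace ℝ (Fin 3))) = Set.range σ.points) →
      σ.circumcenter ∈ σ.interior

/-- `L` can appear as the link of a vertex in a `3`-well-centered mesh in `ℝ³`. -/
def AppearsAsLinkInThreeWellCenteredMesh {V : Type*} (L : PreAbstractSimplicialComplex V) : Prop :=
  ∃ M : Geometry.SimplicialComplex ℝ (EuclideanSpace ℝ (Fin 3)), IsThreeWellCentered M ∧
    ∃ u ∈ M.vertices, L.IsIsomorphic (vertexLink M u)

/-! ### Two well-centered tetrahedra sharing a triangle. -/

section WellCentered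

open scoped RealInnerProductSpace

variable {E : Type*} [NormedAddCommGroup E] [InnerProductSpace ℝ E]

/-! Suppose `L` is the link of `u` in a well-centered mesh, and put `u` at the origin. The cones
over the triangles of `L` form a fan, because simplices of the mesh meet only along common faces.
Every edge of `L` lies in a second triangle, so this fan has no boundary and fills space
(`exists_mem_coneOver_of_fan`). Hence the direction opposite to any vertex `b` lies in the cone over
some triangle.

For the complexes considered, `b` can be chosen so that each triangle `p q r` avoiding it has an
edge `p q` for which `p q b` is also a triangle. Two tetrahedra then share the triangle `u p q`. The
projection `o` of both circumcenters to its plane is the circumcenter of that triangle.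
Well-centeredness forces `o` to have positive inner product with both `r` and `b`
(`inner_pos_of_circumcenter`), while its inner products with `p` and `q` are half their squared
lengths. Thus `-b` lies on the negative side of the hyperplane orthogonal to `o` and the cone over
`p q r` on the other side: a contradiction.

That `K` is a ball with boundary sphere is seen by parametrizing it by a convex body: a corner
simplex for `m = 4`, and otherwise the double cone `‖z‖ + |t| ≤ 1` in `ℂ × ℝ`, whose axis becomes
the common edge and whose rim becomes the cycle of the `c i`. -/

/-- The tetrahedron with vertices `0, p, q, r` contains its circumcenter in its interior. -/
def IsWellCenteredAtZero (p q r : E) : Prop :=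
  ∃ (c : E) (α β γ : ℝ), 0 < α ∧ 0 < β ∧ 0 < γ ∧ α + β + γ < 1 ∧
    c = α • p + β • q + γ • r ∧
    2 * ⟪c, p⟫ = ‖p‖ ^ 2 ∧ 2 * ⟪c, q⟫ = ‖q‖ ^ 2 ∧ 2 * ⟪c, r⟫ = ‖r‖ ^ 2

/-- Here `o` stands for the circumcenter of `0, p, q`, the foot of the perpendicular from `c`. If
`⟪o, r⟫ ≤ 0`, then `r` gets its inner product with `c` from the normal part `c - o` alone, so `‖r‖ ≤
2‖c - o‖`; but `‖c - o‖ ≤ γ‖r‖`, whence `γ ≥ 1/2` and `α + β < 1/2`. Too little weight is then left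
on `p` and `q` to produce `o`: one gets `‖o‖² ≤ 2(α + β)‖o‖² < ‖o‖²`. -/
theorem inner_pos_of_circumcenter {p q r c o : E} {α β γ : ℝ} (hα : 0 < α) (hβ : 0 < β)
    (hγ : 0 < γ) (hs : α + β + γ < 1) (hc : c = α • p + β • q + γ • r)
    (hp : 2 * ⟪c, p⟫ = ‖p‖ ^ 2) (hq : 2 * ⟪c, q⟫ = ‖q‖ ^ 2) (hr : 2 * ⟪c, r⟫ = ‖r‖ ^ 2)
    (hop : ⟪o, p⟫ = ⟪c, p⟫) (hoq : ⟪o, q⟫ = ⟪c, q⟫) (hoc : ⟪o, c⟫ = ‖o‖ ^ 2)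
    (hp0 : p ≠ 0) (hr0 : r ≠ 0) : 0 < ⟪o, r⟫ := by
  by_contra! hor
  have hpp : 0 < ‖p‖ := norm_pos_iff.2 hp0
  have hrr : 0 < ‖r‖ := norm_pos_iff.2 hr0
  -- A chord of the circle about `o` through `0` is at most a diameter.
  have key : ∀ x : E, 2 * ⟪c, x⟫ = ‖x‖ ^ 2 → ⟪o, x⟫ = ⟪c, x⟫ → ‖x‖ ≤ 2 * ‖o‖ := by
    intro x h1 h2
    have h3 := real_inner_le_norm o x
    rcases (norm_nonneg x).eq_or_lt with h0 | h0
    · rw [← h0]; positivity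
    · nlinarith
  have hpo := key p hp hop
  have hqo := key q hq hoq
  have ho0 : 0 < ‖o‖ := by linarith
  have ho : ‖o‖ ^ 2 = α * ⟪c, p⟫ + β * ⟪c, q⟫ + γ * ⟪o, r⟫ := by
    rw [← hoc, ← hop, ← hoq]
    nth_rewrite 1 [hc]
    simp [inner_add_right, inner_smul_right]
  -- The vector `c - o` is orthogonal to `p` and `q`, so only the term `γ • r` of `c` contributes.
  have hw : ‖c - o‖ ^ 2 = γ * ⟪c - o, r⟫ := by
    have h1 : ‖c - o‖ ^ 2 = ⟪c - o, c⟫ - (⟪o, c⟫ - ‖o‖ ^ 2) := by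
      rw [← real_inner_self_eq_norm_sq, ← real_inner_self_eq_norm_sq]
      simp only [inner_sub_left, inner_sub_right, real_inner_comm c o]
    rw [h1, hoc, sub_self, sub_zero]
    nth_rewrite 2 [hc]
    simp only [inner_add_right, inner_smul_right, inner_sub_left, hop, hoq]
    ring
  have hwr : ‖r‖ ^ 2 ≤ 2 * ⟪c - o, r⟫ := by
    rw [inner_sub_left]; linarith
  have hcs := real_inner_le_norm (c - o) r
  have hwn : 0 ≤ ‖c - o‖ := norm_nonneg _
  have hwpos : 0 < ‖c - o‖ := by
    rcases hwn.eq_or_lt with h0 | h0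
    · rw [← h0] at hcs; nlinarith
    · exact h0
  have h1 : ‖c - o‖ ≤ γ * ‖r‖ := by
    have : ‖c - o‖ * ‖c - o‖ ≤ (γ * ‖r‖) * ‖c - o‖ := by nlinarith
    exact le_of_mul_le_mul_right this hwpos
  have h2 : ‖r‖ ≤ 2 * ‖c - o‖ := by
    have : ‖r‖ * ‖r‖ ≤ (2 * ‖c - o‖) * ‖r‖ := by nlinarith
    exact le_of_mul_le_mul_right this hrr
  have hγ2 : 1 / 2 ≤ γ := by
    have : 1 * ‖r‖ ≤ (2 * γ) * ‖r‖ := by linarith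
    linarith [le_of_mul_le_mul_right this hrr]
  have h3 : ‖p‖ ^ 2 ≤ 4 * ‖o‖ ^ 2 := by nlinarith
  have h4 : ‖q‖ ^ 2 ≤ 4 * ‖o‖ ^ 2 := by nlinarith [norm_nonneg q]
  have h5 : ‖o‖ ^ 2 ≤ 2 * (α + β) * ‖o‖ ^ 2 := by nlinarith
  nlinarith [sq_pos_of_pos ho0]

/-- Two well-centered tetrahedra that share the triangle `0, p, q` cannot surround `0`: the point
opposite to the fourth vertex of one is not in the cone spanned by the other. -/
theorem IsWellCenteredAtZero.neg_ne {p q r b : E} (h₁ : IsWellCenteredAtZero p q r)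
    (h₂ : IsWellCenteredAtZero p q b) (hp : p ≠ 0) (hr : r ≠ 0) (hb : b ≠ 0) {x y z : ℝ}
    (hx : 0 ≤ x) (hy : 0 ≤ y) (hz : 0 ≤ z) : -b ≠ x • p + y • q + z • r := by
  obtain ⟨c, α, β, γ, hα, hβ, hγ, hs, hc, hcp, hcq, hcr⟩ := h₁
  obtain ⟨c', α', β', γ', hα', hβ', hγ', hs', hc', hcp', hcq', hcb'⟩ := h₂
  intro heq
  let W : Submodule ℝ E := Submodule.span ℝ {p, q}
  have : FiniteDimensional ℝ W := FiniteDimensional.span_of_finite ℝ (Set.toFinite _)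
  have hpW : p ∈ W := Submodule.subset_span (by simp)
  have hqW : q ∈ W := Submodule.subset_span (by simp)
  have hproj : ∀ d w : E, w ∈ W → ⟪W.starProjection d, w⟫ = ⟪d, w⟫ := by
    intro d w hw
    rw [W.inner_starProjection_left_eq_right, Submodule.starProjection_eq_self_iff.2 hw]
  have hoo : ∀ d : E, ⟪W.starProjection d, d⟫ = ‖W.starProjection d‖ ^ 2 := by
    intro d
    rw [← real_inner_self_eq_norm_sq, hproj d _ (W.starProjection_apply_mem d), real_inner_comm]
  -- Both circumcenters have inner products `‖p‖²/2` and `‖q‖²/2` with `p` and `q`, so they differ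
  -- by a normal of `W`.
  have hsame : W.starProjection c' = W.starProjection c := by
    rw [← sub_eq_zero, ← map_sub, Submodule.starProjection_apply_eq_zero_iff]
    rw [Submodule.mem_orthogonal']
    intro w hw
    refine Submodule.span_induction (p := fun w _ => ⟪c' - c, w⟫ = 0) ?_ ?_ ?_ ?_ hw
    · rintro w (rfl | rfl) <;> rw [inner_sub_left] <;> linarith
    · simp
    · intro u v _ _ hu hv; rw [inner_add_right, hu, hv, add_zero]
    · intro a u _ hu; rw [inner_smul_right, hu, mul_zero]
  have h1 := inner_pos_of_circumcenter hα hβ hγ hs hc hcp hcq hcr (hproj c p hpW) (hproj c q hqW)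
    (hoo c) hp hr
  have h2 := inner_pos_of_circumcenter hα' hβ' hγ' hs' hc' hcp' hcq' hcb' (hproj c' p hpW)
    (hproj c' q hqW) (hoo c') hp hb
  rw [hsame] at h2
  -- Pairing with `o` makes the left side negative and the right side nonnegative.
  have h3 := congrArg (fun v => ⟪W.starProjection c, v⟫) heq
  simp only [inner_neg_right, inner_add_right, inner_smul_right] at h3
  have h4 : 0 ≤ ⟪W.starProjection c, p⟫ := by rw [hproj c p hpW]; nlinarith [sq_nonneg ‖p‖]
  have h5 : 0 ≤ ⟪W.starProjection c, q⟫ := by rw [hproj c q hqW]; nlinarith [sq_nonneg ‖q‖]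
  have := mul_nonneg hx h4
  have := mul_nonneg hy h5
  have := mul_nonneg hz h1.le
  linarith

end WellCentered

/-! ### Simplicial cones and their facets. -/

section Fan

open Filter Topology

variable {V E : Type*} [AddCommGroup E] [Module ℝ E]

/-- The cone spanned by the vectors `v i`, `i ∈ t`. -/
def coneOver (v : V → E) (t : Finset V) : Set E :=
  {y | ∃ w : V → ℝ, (∀ i, 0 ≤ w i) ∧ y = ∑ i ∈ t, w i • v i}

theorem mem_coneOver_of_nonneg {v : V → E} {t : Finset V} {w : V → ℝ} (hw : ∀ i ∈ t, 0 ≤ w i) :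
    ∑ i ∈ t, w i • v i ∈ coneOver v t := by
  -- Weights off `t` do not enter the sum but must be nonnegative too; truncation at `0` repairs
  -- them.
  refine ⟨fun i => max 0 (w i), fun i => le_max_left _ _, Finset.sum_congr rfl fun i hi => ?_⟩
  simp only [max_eq_right (hw i hi)]

theorem coneOver_mono [DecidableEq V] {v : V → E} {s t : Finset V} (h : s ⊆ t) :
    coneOver v s ⊆ coneOver v t := by
  rintro _ ⟨w, hw, rfl⟩
  refine ⟨fun i => if i ∈ s then w i else 0, fun i => by dsimp only; split_ifs <;> simp [hw], ?_⟩
  rw [← Finset.sum_subset h]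
  · exact Finset.sum_congr rfl fun i hi => by simp [hi]
  · intro i _ hi; simp [hi]

/-- Positive coordinates absorb a small perturbation of either sign, so only the vanishing ones
restrict the direction. -/
theorem eventually_add_smul_mem_coneOver {v : V → E} {t : Finset V} {w d : V → ℝ}
    (hw : ∀ i ∈ t, 0 ≤ w i) (hd : ∀ i ∈ t, w i = 0 → 0 ≤ d i) :
    ∀ᶠ s : ℝ in 𝓝[>] 0, ∑ i ∈ t, w i • v i + s • ∑ i ∈ t, d i • v i ∈ coneOver v t := by
  have h : ∀ i ∈ t, ∀ᶠ s : ℝ in 𝓝[>] 0, 0 ≤ w i + s * d i := by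
    intro i hi
    rcases (hw i hi).eq_or_lt with h0 | h0
    · filter_upwards [self_mem_nhdsWithin] with s hs
      rw [← h0, zero_add]
      exact mul_nonneg (le_of_lt hs) (hd i hi h0.symm)
    · have hc : Continuous fun s : ℝ => w i + s * d i := by fun_prop
      have : ∀ᶠ s : ℝ in 𝓝 0, 0 < w i + s * d i :=
        hc.continuousAt.eventually_const_lt (by simpa using h0)
      filter_upwards [this.filter_mono nhdsWithin_le_nhds] with s hs using hs.le
  filter_upwards [(Filter.eventually_all_finset t).2 h] with s hs
  have : ∑ i ∈ t, w i • v i + s • ∑ i ∈ t, d i • v i = ∑ i ∈ t, (w i + s * d i) • v i := by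
    rw [Finset.smul_sum, ← Finset.sum_add_distrib]
    exact Finset.sum_congr rfl fun i _ => by rw [add_smul, mul_smul]
  rw [this]
  exact mem_coneOver_of_nonneg hs

theorem eq_of_sum_smul_eq {v : V → E} {t : Finset V}
    (hli : LinearIndependent ℝ (fun i : t => v i)) {w w' : V → ℝ}
    (h : ∑ i ∈ t, w i • v i = ∑ i ∈ t, w' i • v i) : ∀ i ∈ t, w i = w' i := by
  intro i hi
  have h0 : ∑ j : t, (w j - w' j) • v j = 0 := by
    rw [Finset.sum_coe_sort t fun j => (w j - w' j) • v j]
    simp [sub_smul, Finset.sum_sub_distrib, h]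
  have := Fintype.linearIndependent_iff.1 hli (fun j => w j - w' j) h0 ⟨i, hi⟩
  exact sub_eq_zero.1 this

/-- If two simplicial cones share the facet opposite to `j` and meet only along it, then their
remaining generators lie strictly on different sides of the facet. -/
theorem coeff_neg_of_inter_subset [DecidableEq V] {v : V → E} {u : Finset V} {j j' : V}
    (hj : j ∉ u) (hj' : j' ∉ u)
    (hli' : LinearIndependent ℝ (fun i : (insert j' u : Finset V) => v i))
    (hinter : coneOver v (insert j u) ∩ coneOver v (insert j' u) ⊆ coneOver v u)
    {e : V → ℝ} (he : v j' = ∑ i ∈ insert j u, e i • v i) : e j < 0 := by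
  by_contra! hej
  -- Start from the sum of the generators of the facet, where all coordinates but `j` are positive.
  -- If `e j ≥ 0`, a small move towards `v j'` stays in the first cone, and it clearly stays in the
  -- second.
  have h1 := eventually_add_smul_mem_coneOver (v := v) (t := insert j u)
    (w := fun i => if i = j then 0 else 1) (d := e)
    (fun i _ => by split_ifs <;> norm_num) (fun i _ h => by
      split_ifs at h with hi
      · rw [hi]; exact hej
      · norm_num at h)
  obtain ⟨s, hs, hs0⟩ := (h1.and self_mem_nhdsWithin).exists
  have hs0 : 0 < s := hs0
  rw [← he] at hs
  have h2 : ∑ i ∈ insert j u, (if i = j then (0 : ℝ) else 1) • v i + s • v j' =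
      ∑ i ∈ insert j' u, (if i = j' then s else 1) • v i := by
    rw [Finset.sum_insert hj, Finset.sum_insert hj', if_pos rfl, if_pos rfl, zero_smul, zero_add,
      add_comm]
    congr 1
    refine Finset.sum_congr rfl fun i hi => ?_
    rw [if_neg (ne_of_mem_of_not_mem hi hj), if_neg (ne_of_mem_of_not_mem hi hj')]
  have h3 : ∑ i ∈ insert j' u, (if i = j' then s else 1) • v i ∈ coneOver v (insert j' u) :=
    mem_coneOver_of_nonneg fun i _ => by split_ifs <;> positivity
  rw [h2] at hs
  obtain ⟨w, -, hweq⟩ := hinter ⟨hs, h3⟩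
  -- The common point would lie in the cone over `u`, with coefficient `0` on `v j'`; but that
  -- coefficient is `s > 0`.
  have h4 : ∑ i ∈ u, w i • v i = ∑ i ∈ insert j' u, (if i = j' then 0 else w i) • v i := by
    rw [Finset.sum_insert hj', if_pos rfl, zero_smul, zero_add]
    exact Finset.sum_congr rfl fun i hi => by rw [if_neg (ne_of_mem_of_not_mem hi hj')]
  rw [h4] at hweq
  have := eq_of_sum_smul_eq hli' hweq j' (Finset.mem_insert_self _ _)
  simp at this
  linarith

theorem exists_eq_sum_smul [DecidableEq V] [FiniteDimensional ℝ E] {v : V → E} {t : Finset V}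
    (hcard : t.card = Module.finrank ℝ E) (hli : LinearIndependent ℝ (fun i : t => v i)) (y : E) :
    ∃ w : V → ℝ, y = ∑ i ∈ t, w i • v i := by
  have hspan : Submodule.span ℝ (Set.range fun i : t => v i) = ⊤ :=
    hli.span_eq_top_of_card_eq_finrank' (by simpa using hcard)
  have hy : y ∈ Submodule.span ℝ (Set.range fun i : t => v i) := hspan ▸ Submodule.mem_top
  obtain ⟨c, hc⟩ := (Submodule.mem_span_range_iff_exists_fun ℝ).1 hy
  refine ⟨fun i => if h : i ∈ t then c ⟨i, h⟩ else 0, ?_⟩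
  rw [← hc, ← Finset.sum_coe_sort t]
  exact Finset.sum_congr rfl fun i _ => by simp

end Fan

/-! ### Completeness of a fan without boundary. -/

section FanComplete

open Filter Topology

variable {V E : Type*} [DecidableEq V] [NormedAddCommGroup E] [NormedSpace ℝ E]

/-- The cone is the image of a closed orthant under an injective linear map from a
finite-dimensional space, which is a closed embedding. -/
theorem isClosed_coneOver {v : V → E} {t : Finset V}
    (hli : LinearIndependent ℝ (fun i : t => v i)) : IsClosed (coneOver v t) := by
  let φ : (t → ℝ) →ₗ[ℝ] E := Fintype.linearCombination ℝ (fun i : t => v i)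
  have hφ : Function.Injective φ := by
    rw [← LinearMap.ker_eq_bot, LinearMap.ker_eq_bot']
    intro c hc
    exact funext (Fintype.linearIndependent_iff.1 hli c
      (by simpa [φ, Fintype.linearCombination_apply] using hc))
  have hcl : IsClosed (φ '' {c | ∀ i, 0 ≤ c i}) := by
    refine (LinearMap.isClosedEmbedding_of_injective (LinearMap.ker_eq_bot.2 hφ)).isClosedMap _ ?_
    simp only [Set.ofPred_forall]
    exact isClosed_iInter fun i => isClosed_le continuous_const (continuous_apply i)
  convert hcl using 1
  ext y
  constructor
  · rintro ⟨w, hw, rfl⟩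
    refine ⟨fun i => w i, fun i => hw i, ?_⟩
    simp only [φ, Fintype.linearCombination_apply]
    exact Finset.sum_coe_sort t fun i => w i • v i
  · rintro ⟨c, hc, rfl⟩
    refine ⟨fun i => if h : i ∈ t then c ⟨i, h⟩ else 0, fun i => ?_, ?_⟩
    · dsimp only; split_ifs
      · exact hc _
      · exact le_rfl
    · simp only [φ, Fintype.linearCombination_apply]
      rw [← Finset.sum_coe_sort t]
      exact Finset.sum_congr rfl fun i _ => by simp

theorem dense_compl_submodule {W : Submodule ℝ E} (hW : W ≠ ⊤) : Dense ((W : Set E)ᶜ) := by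
  rw [← interior_eq_empty_iff_dense_compl]
  by_contra h
  exact hW (W.eq_top_of_nonempty_interior' (Set.nonempty_iff_ne_empty.2 h))

/-- The cone spanned by a basis is not covered by finitely many proper subspaces. -/
theorem exists_mem_coneOver_forall_notMem [FiniteDimensional ℝ E] {v : V → E} {t : Finset V}
    (hcard : t.card = Module.finrank ℝ E) (hli : LinearIndependent ℝ (fun i : t => v i))
    {ι : Type*} [Finite ι] (W : ι → Submodule ℝ E) (hW : ∀ i, W i ≠ ⊤) :
    ∃ x ∈ coneOver v t, ∀ i, x ∉ W i := by
  have := FiniteDimensional.complete ℝ E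
  have hdense : Dense (⋂ i, ((W i : Set E)ᶜ)) :=
    dense_iInter_of_isOpen (fun i => (W i).closed_of_finiteDimensional.isOpen_compl)
      fun i => dense_compl_submodule (hW i)
  have hspan : Submodule.span ℝ (Set.range fun i : t => v i) = ⊤ :=
    hli.span_eq_top_of_card_eq_finrank' (by simpa using hcard)
  let b : Module.Basis t ℝ E := Module.Basis.mk hli hspan.ge
  have hopen : IsOpen {x : E | ∀ i, 0 < b.equivFun x i} := by
    simp only [Set.ofPred_forall]
    refine isOpen_iInter_of_finite fun i => isOpen_lt continuous_const ?_
    exact (continuous_apply i).comp (LinearMap.continuous_of_finiteDimensional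
      (b.equivFun : E →ₗ[ℝ] (t → ℝ)))
  have hne : {x : E | ∀ i, 0 < b.equivFun x i}.Nonempty :=
    ⟨b.equivFun.symm fun _ => 1, fun i => by rw [LinearEquiv.apply_symm_apply]; exact one_pos⟩
  -- The complements of the subspaces are open and dense, so their intersection meets the open cone
  -- of points with positive coordinates.
  obtain ⟨x, hx, hxW⟩ := hdense.inter_open_nonempty _ hopen hne
  refine ⟨x, ?_, fun i hi => Set.mem_iInter.1 hxW i hi⟩
  refine ⟨fun i => if h : i ∈ t then b.equivFun x ⟨i, h⟩ else 0, fun i => ?_, ?_⟩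
  · dsimp only; split_ifs
    · exact (hx _).le
    · exact le_rfl
  · rw [← Finset.sum_coe_sort t]
    conv_lhs => rw [← b.sum_equivFun x]
    exact Finset.sum_congr rfl fun i _ => by simp [b]

/-- A finite fan of full-dimensional simplicial cones in which every facet of every cone belongs
to another cone is complete. -/
theorem exists_mem_coneOver_of_fan [FiniteDimensional ℝ E] [Finite V] {v : V → E}
    {T : Set (Finset V)} (hne : T.Nonempty)
    (hcard : ∀ t ∈ T, t.card = Module.finrank ℝ E)
    (hli : ∀ t ∈ T, LinearIndependent ℝ (fun i : t => v i))
    (hinter : ∀ t ∈ T, ∀ t' ∈ T, coneOver v t ∩ coneOver v t' ⊆ coneOver v (t ∩ t'))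
    (hadj : ∀ t ∈ T, ∀ j ∈ t, ∃ t' ∈ T, t' ≠ t ∧ t.erase j ⊆ t') (y : E) :
    ∃ t ∈ T, y ∈ coneOver v t := by
  classical
  by_contra! hy
  let U : Set E := ⋃ t ∈ T, coneOver v t
  have hU : IsClosed U := (Set.toFinite T).isClosed_biUnion fun t ht => isClosed_coneOver (hli t ht)
  have hyU : y ∉ U := by simpa [U] using hy
  obtain ⟨t₀, ht₀⟩ := hne
  -- The span of `y` and at most `n - 2` generators is a proper subspace. A starting point `x`
  -- outside all of these sees `y` along a segment that meets no face of codimension two before `y`.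
  let S : Set (Finset V) := {s | s.card + 2 ≤ Module.finrank ℝ E}
  let W : S → Submodule ℝ E := fun s =>
    Submodule.span ℝ ((insert y (s.1.image v) : Finset E) : Set E)
  have hW : ∀ s, W s ≠ ⊤ := by
    intro s hs
    have h1 : Module.finrank ℝ (W s) ≤ (insert y (s.1.image v) : Finset E).card :=
      finrank_span_finset_le_card _
    rw [hs, finrank_top] at h1
    have h2 := Finset.card_insert_le y (s.1.image v)
    have h3 := Finset.card_image_le (s := s.1) (f := v)
    have := s.2
    simp only [S, Set.mem_ofPred_eq] at this
    omega
  obtain ⟨x, hx, hxW⟩ := exists_mem_coneOver_forall_notMem (hcard t₀ ht₀) (hli t₀ ht₀) W hW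
  let A : Set ℝ := Set.Icc 0 1 ∩ (fun s : ℝ => x + s • (y - x)) ⁻¹' U
  have hA : IsCompact A := isCompact_Icc.inter_right (hU.preimage (by fun_prop))
  have hA0 : (0 : ℝ) ∈ A := by
    refine ⟨by simp, ?_⟩
    simp only [Set.mem_preimage, zero_smul, add_zero]
    exact Set.mem_biUnion ht₀ hx
  -- The last point of the segment in the closed set `U`. It is enough to show that the segment
  -- stays in `U` slightly longer.
  obtain ⟨s, ⟨hs01, hsU⟩, hsmax⟩ := hA.exists_isGreatest ⟨0, hA0⟩
  have hs1 : s < 1 := by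
    refine lt_of_le_of_ne hs01.2 ?_
    rintro rfl
    exact hyU (by simpa using hsU)
  suffices h : ∀ᶠ r : ℝ in 𝓝[>] 0, x + s • (y - x) + r • (y - x) ∈ U by
    have hlt : ∀ᶠ r : ℝ in 𝓝[>] 0, r < 1 - s :=
      (Iio_mem_nhds (by linarith : (0 : ℝ) < 1 - s)) |> mem_nhdsWithin_of_mem_nhds
    obtain ⟨r, ⟨hr, hr1⟩, hr0⟩ := ((h.and hlt).and self_mem_nhdsWithin).exists
    have hr0 : 0 < r := hr0
    have : s + r ∈ A := by
      refine ⟨⟨by linarith [hs01.1], by linarith⟩, ?_⟩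
      simpa only [Set.mem_preimage, add_smul, add_assoc] using hr
    linarith [hsmax this]
  obtain ⟨t, ht, w, hw, hz⟩ : ∃ t ∈ T, x + s • (y - x) ∈ coneOver v t := by simpa [U] using hsU
  -- At most one coordinate vanishes there. Otherwise solving for `x`, possible as `s < 1`, puts it
  -- in an excluded subspace.
  have hone : ∀ i ∈ t, ∀ j ∈ t, i ≠ j → w i = 0 → w j = 0 → False := by
    intro i hi j hj hij hwi hwj
    have hc : ((t.erase i).erase j).card + 2 ≤ Module.finrank ℝ E := by
      rw [Finset.card_erase_of_mem (Finset.mem_erase.2 ⟨hij.symm, hj⟩),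
        Finset.card_erase_of_mem hi, ← hcard t ht]
      have := Finset.one_lt_card.2 ⟨i, hi, j, hj, hij⟩
      omega
    refine hxW ⟨(t.erase i).erase j, hc⟩ ?_
    have h1 : x + s • (y - x) = ∑ l ∈ (t.erase i).erase j, w l • v l := by
      rw [hz, Finset.sum_erase _ (by rw [hwj, zero_smul]),
        Finset.sum_erase _ (by rw [hwi, zero_smul])]
    have h2 : x = (1 - s)⁻¹ • (∑ l ∈ (t.erase i).erase j, w l • v l - s • y) := by
      rw [← h1, eq_inv_smul_iff₀ (by linarith : (1 : ℝ) - s ≠ 0)]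
      module
    rw [h2]
    refine Submodule.smul_mem _ _ (Submodule.sub_mem _ (Submodule.sum_mem _ fun l hl => ?_) ?_)
    · refine Submodule.smul_mem _ _ (Submodule.subset_span ?_)
      exact Finset.mem_coe.2 (Finset.mem_insert_of_mem (Finset.mem_image_of_mem v hl))
    · exact Submodule.smul_mem _ _ (Submodule.subset_span
        (Finset.mem_coe.2 (Finset.mem_insert_self _ _)))
  obtain ⟨d, hd⟩ := exists_eq_sum_smul (hcard t ht) (hli t ht) (y - x)
  by_cases hgood : ∀ i ∈ t, w i = 0 → 0 ≤ d i
  · have := eventually_add_smul_mem_coneOver (v := v) (fun i _ => hw i) hgood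
    rw [← hz, ← hd] at this
    filter_upwards [this] with r hr using Set.mem_biUnion ht hr
  push Not at hgood
  obtain ⟨j, hj, hwj, hdj⟩ := hgood
  -- The segment leaves `t` through the relative interior of the facet opposite `j`, and continues
  -- in the cone on the other side.
  obtain ⟨t', ht', htt', hsub⟩ := hadj t ht j hj
  set u := t.erase j with hu
  have hju : j ∉ u := Finset.notMem_erase _ _
  have htu : t = insert j u := (Finset.insert_erase hj).symm
  obtain ⟨j', hj'u, rfl⟩ : ∃ j', j' ∉ u ∧ t' = insert j' u := by
    have h1 : (t' \ u).card = 1 := by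
      rw [Finset.card_sdiff_of_subset hsub, hcard t' ht', ← hcard t ht, htu,
        Finset.card_insert_of_notMem hju]
      omega
    obtain ⟨j', hj'⟩ := Finset.card_eq_one.1 h1
    refine ⟨j', fun h => ?_, ?_⟩
    · have : j' ∈ t' \ u := by rw [hj']; exact Finset.mem_singleton_self _
      exact (Finset.mem_sdiff.1 this).2 h
    · rw [← Finset.sdiff_union_of_subset hsub, hj']; rfl
  have hjj' : j ≠ j' := by rintro rfl; exact htt' htu.symm
  obtain ⟨e, he⟩ := exists_eq_sum_smul (hcard t ht) (hli t ht) (v j')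
  have hsubu : t ∩ insert j' u ⊆ u := by
    intro i hi
    rw [Finset.mem_inter, htu, Finset.mem_insert, Finset.mem_insert] at hi
    rcases hi with ⟨h1 | h1, h2 | h2⟩
    · exact absurd (h1.symm.trans h2) hjj'
    · exact h2
    · exact h1
    · exact h1
  have hej : e j < 0 := coeff_neg_of_inter_subset hju hj'u (hli _ ht')
    (htu ▸ (hinter t ht _ ht').trans (coneOver_mono hsubu)) (htu ▸ he)
  -- The direction `y - x` is rewritten in the generators of the neighbouring cone by eliminating `v
  -- j`. The coefficient of `v j'` is `d j / e j`, a quotient of two negative numbers, and all other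
  -- coordinates of the current point are positive.
  have hev := eventually_add_smul_mem_coneOver (v := v) (t := insert j' u)
    (w := fun i => if i = j' then 0 else w i)
    (d := fun i => if i = j' then d j / e j else d i - d j / e j * e i)
    (fun i _ => by split_ifs <;> simp [hw]) (fun i hi h => by
      split_ifs at h ⊢ with hij'
      · exact (div_pos_of_neg_of_neg hdj hej).le
      · have hiu : i ∈ u := (Finset.mem_insert.1 hi).resolve_left hij'
        exact (hone i (htu ▸ Finset.mem_insert_of_mem hiu) j hj (fun h => hju (h ▸ hiu)) h hwj).elim)
  have hne' : ∀ i ∈ u, i ≠ j' := fun i hi h => hj'u (h ▸ hi)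
  have e1 : ∑ i ∈ insert j' u, (if i = j' then 0 else w i) • v i = x + s • (y - x) := by
    rw [hz, htu, Finset.sum_insert hj'u, Finset.sum_insert hju, hwj, if_pos rfl]
    congr 1
    · simp
    · exact Finset.sum_congr rfl fun i hi => by rw [if_neg (hne' i hi)]
  have e2 : ∑ i ∈ insert j' u, (if i = j' then d j / e j else d i - d j / e j * e i) • v i
      = y - x := by
    have h1 : ∑ i ∈ u, (if i = j' then d j / e j else d i - d j / e j * e i) • v i =
        ∑ i ∈ u, d i • v i - (d j / e j) • ∑ i ∈ u, e i • v i := by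
      rw [Finset.smul_sum, ← Finset.sum_sub_distrib]
      exact Finset.sum_congr rfl fun i hi => by rw [if_neg (hne' i hi), sub_smul, mul_smul]
    rw [Finset.sum_insert hj'u, if_pos rfl, h1, hd, he, htu, Finset.sum_insert hju,
      Finset.sum_insert hju, smul_add, smul_smul, div_mul_cancel₀ _ hej.ne]
    abel
  rw [e1, e2] at hev
  filter_upwards [hev] with r hr using Set.mem_biUnion ht' hr

end FanComplete

/-! ### The link of a mesh vertex as a fan, and the obstruction. -/

section Link

open Filter Topology

theorem smul_mem_coneOver {V E : Type*} [AddCommGroup E] [Module ℝ E] {v : V → E} {t : Finset V}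
    {y : E} (hy : y ∈ coneOver v t) {r : ℝ} (hr : 0 ≤ r) : r • y ∈ coneOver v t := by
  obtain ⟨w, hw, rfl⟩ := hy
  refine ⟨fun i => r * w i, fun i => mul_nonneg hr (hw i), ?_⟩
  rw [Finset.smul_sum]
  exact Finset.sum_congr rfl fun i _ => by rw [mul_smul]

theorem add_mem_coneOver {V E : Type*} [AddCommGroup E] [Module ℝ E] {v : V → E} {t : Finset V}
    {y z : E} (hy : y ∈ coneOver v t) (hz : z ∈ coneOver v t) : y + z ∈ coneOver v t := by
  obtain ⟨w, hw, rfl⟩ := hy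
  obtain ⟨w', hw', rfl⟩ := hz
  refine ⟨fun i => w i + w' i, fun i => add_nonneg (hw i) (hw' i), ?_⟩
  rw [← Finset.sum_add_distrib]
  exact Finset.sum_congr rfl fun i _ => by rw [add_smul]

theorem mem_coneOver_self {V E : Type*} [DecidableEq V] [AddCommGroup E] [Module ℝ E] {v : V → E}
    {t : Finset V} {i : V} (hi : i ∈ t) : v i ∈ coneOver v t :=
  ⟨fun j => if j = i then 1 else 0, fun j => by dsimp only; split_ifs <;> norm_num, by simp [hi]⟩

theorem sub_mem_coneOver_of_mem_convexHull {V E : Type*} [DecidableEq V] [AddCommGroup E]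
    [Module ℝ E] {f : V → E} {u x : E} {t : Finset V}
    (hx : x ∈ convexHull ℝ (insert u (f '' t))) : x - u ∈ coneOver (fun i => f i - u) t := by
  refine convexHull_min (t := {x | x - u ∈ coneOver (fun i => f i - u) t}) ?_ ?_ hx
  · rintro y (rfl | ⟨i, hi, rfl⟩)
    · exact ⟨fun _ => 0, fun _ => le_rfl, by simp⟩
    · exact mem_coneOver_self (v := fun i => f i - u) hi
  · intro y hy z hz a b ha hb hab
    have : a • y + b • z - u = a • (y - u) + b • (z - u) := by
      rw [smul_sub, smul_sub, sub_add_sub_comm, ← add_smul, hab, one_smul]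
    change a • y + b • z - u ∈ coneOver _ _
    rw [this]
    exact add_mem_coneOver (smul_mem_coneOver hy ha) (smul_mem_coneOver hz hb)

/-- For small `r` the weights `r * w i` sum to less than one, and the apex `u` takes the remainder.
The index `none` carries that apex. -/
theorem eventually_mem_convexHull_of_mem_coneOver {V E : Type*} [AddCommGroup E] [Module ℝ E]
    {f : V → E} {u y : E} {t : Finset V} (hy : y ∈ coneOver (fun i => f i - u) t) :
    ∀ᶠ r : ℝ in 𝓝[>] 0, u + r • y ∈ convexHull ℝ (insert u (f '' t)) := by
  obtain ⟨w, hw, rfl⟩ := hy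
  have hc : Continuous fun r : ℝ => r * ∑ i ∈ t, w i := by fun_prop
  have h1 : ∀ᶠ r : ℝ in 𝓝 0, r * ∑ i ∈ t, w i < 1 :=
    hc.continuousAt.eventually_lt_const (by simp)
  filter_upwards [h1.filter_mono nhdsWithin_le_nhds, self_mem_nhdsWithin] with r hr hr0
  have hr0 : 0 < r := hr0
  have h2 : u + r • ∑ i ∈ t, w i • (f i - u) = ∑ o ∈ Finset.insertNone t,
      (o.elim (1 - r * ∑ i ∈ t, w i) fun i => r * w i) • (o.elim u f : E) := by
    rw [Finset.sum_insertNone]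
    simp only [Option.elim, smul_sub, Finset.sum_sub_distrib, ← Finset.sum_smul, mul_smul,
      Finset.smul_sum, sub_smul, one_smul]
    abel
  rw [h2]
  refine (convex_convexHull ℝ _).sum_mem ?_ ?_ ?_
  · rintro (_ | i) _
    · simp only [Option.elim]; linarith
    · exact mul_nonneg hr0.le (hw i)
  · rw [Finset.sum_insertNone]
    simp only [Option.elim]
    rw [Finset.mul_sum]; ring
  · rintro (_ | i) hi
    · exact subset_convexHull ℝ _ (Set.mem_insert _ _)
    · exact subset_convexHull ℝ _ (Set.mem_insert_of_mem _
        ⟨i, Finset.some_mem_insertNone.1 hi, rfl⟩)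

/-- A well-centered tetrahedron `u, p, q, r`, translated so that `u` becomes the origin. -/
theorem isWellCenteredAtZero_of_circumcenter_mem_interior {E : Type*} [NormedAddCommGroup E]
    [InnerProductSpace ℝ E] (σ : Affine.Simplex ℝ E 3) (h : σ.circumcenter ∈ σ.interior) :
    IsWellCenteredAtZero (σ.points 1 - σ.points 0) (σ.points 2 - σ.points 0)
      (σ.points 3 - σ.points 0) := by
  obtain ⟨w, hw1, hw, hc⟩ := h
  rw [Fin.sum_univ_four] at hw1
  have hc' : σ.circumcenter - σ.points 0 = w 1 • (σ.points 1 - σ.points 0) +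
      w 2 • (σ.points 2 - σ.points 0) + w 3 • (σ.points 3 - σ.points 0) := by
    rw [← hc, Finset.affineCombination_eq_linear_combination _ _ _
      (by rw [Fin.sum_univ_four]; exact hw1), Fin.sum_univ_four]
    have : w 0 = 1 - w 1 - w 2 - w 3 := by linarith
    rw [this]; module
  have hdist : ∀ i, 2 * inner ℝ (σ.circumcenter - σ.points 0) (σ.points i - σ.points 0) =
      ‖σ.points i - σ.points 0‖ ^ 2 := by
    intro i
    have h0 := σ.dist_circumcenter_eq_circumradius' 0
    have hi := σ.dist_circumcenter_eq_circumradius' i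
    rw [← h0, dist_eq_norm, dist_eq_norm] at hi
    have h1 := norm_sub_sq_real (σ.circumcenter - σ.points 0) (σ.points i - σ.points 0)
    rw [sub_sub_sub_cancel_right, hi] at h1
    linarith
  exact ⟨_, w 1, w 2, w 3, (hw 1).1, (hw 2).1, (hw 3).1, by linarith [(hw 0).1], hc',
    hdist 1, hdist 2, hdist 3⟩

theorem linearIndependent_sub_of_affineIndependent {V E : Type*} [DecidableEq E]
    [AddCommGroup E] [Module ℝ E] {f : V → E} {u : E} {t : Finset V} (hf : Set.InjOn f t)
    (hu : u ∉ t.image f)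
    (h : AffineIndependent ℝ ((↑) : (insert u (t.image f) : Finset E) → E)) :
    LinearIndependent ℝ (fun i : t => f i - u) := by
  have h1 := (affineIndependent_set_iff_linearIndependent_vsub ℝ
    (s := ((insert u (t.image f) : Finset E) : Set E)) (p₁ := u) (by simp)).1 h
  have hmem : ∀ i : t, f i - u ∈ (fun p : E => p -ᵥ u) ''
      (((insert u (t.image f) : Finset E) : Set E) \ {u}) := by
    intro i
    have hi : f i ∈ t.image f := Finset.mem_image_of_mem f i.2
    exact ⟨f i, ⟨Finset.mem_coe.2 (Finset.mem_insert_of_mem hi), fun h => hu (h ▸ hi)⟩, rfl⟩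
  refine h1.comp (fun i : t => ⟨f i - u, hmem i⟩) ?_
  intro i j hij
  have : f i = f j := by simpa using hij
  exact Subtype.ext (hf i.2 j.2 this)

theorem ne_of_card_eq_three {V : Type*} [DecidableEq V] {p q r : V}
    (h : ({p, q, r} : Finset V).card = 3) : p ≠ q ∧ p ≠ r ∧ q ≠ r := by
  refine ⟨?_, ?_, ?_⟩ <;> rintro rfl
  · have := Finset.card_le_two (a := p) (b := r)
    rw [Finset.insert_eq_of_mem (by simp)] at h; omega
  · have := Finset.card_le_two (a := q) (b := p)
    rw [Finset.insert_eq_of_mem (by simp)] at h; omega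
  · have := Finset.card_le_two (a := p) (b := q)
    rw [Finset.pair_eq_singleton] at h; omega

theorem affineIndependent_of_forall_mem {E ι : Type*} [AddCommGroup E] [Module ℝ E] {s : Finset E}
    (h : AffineIndependent ℝ ((↑) : s → E)) {g : ι → E} (hg : Function.Injective g)
    (hs : ∀ i, g i ∈ s) : AffineIndependent ℝ g :=
  h.comp_embedding
    (⟨fun i => ⟨g i, hs i⟩, fun _ _ hij => hg (congrArg Subtype.val hij)⟩ : ι ↪ s)

theorem isWellCenteredAtZero_of_mem_faces
    {M : Geometry.SimplicialComplex ℝ (EuclideanSpace ℝ (Fin 3))} (hM : IsThreeWellCentered M)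
    {u p q r : EuclideanSpace ℝ (Fin 3)}
    [DecidableEq (EuclideanSpace ℝ (Fin 3))] (hs : {u, p, q, r} ∈ M.faces)
    (hup : u ≠ p) (huq : u ≠ q) (hur : u ≠ r) (hpq : p ≠ q) (hpr : p ≠ r) (hqr : q ≠ r) :
    IsWellCenteredAtZero (p - u) (q - u) (r - u) := by
  have hrange : Set.range ![u, p, q, r] =
      (({u, p, q, r} : Finset (EuclideanSpace ℝ (Fin 3))) : Set _) := by
    simp only [Matrix.range_cons, Matrix.range_empty, Set.union_empty, Finset.coe_insert,
      Finset.coe_singleton, Set.singleton_union]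
  have hginj : Function.Injective ![u, p, q, r] := by
    simp only [Matrix.vecCons, Fin.cons_injective_iff]
    refine ⟨?_, ?_, ?_, ?_, Function.injective_of_subsingleton _⟩ <;>
      simp [hup, huq, hur, hpq, hpr, hqr]
  have hmem : ∀ i, ![u, p, q, r] i ∈ ({u, p, q, r} : Finset (EuclideanSpace ℝ (Fin 3))) :=
    fun i => Finset.mem_coe.1 (hrange ▸ Set.mem_range_self i)
  have hg : AffineIndependent ℝ ![u, p, q, r] :=
    affineIndependent_of_forall_mem (M.indep hs) hginj hmem
  obtain ⟨σ, hσ⟩ : ∃ σ : Affine.Simplex ℝ (EuclideanSpace ℝ (Fin 3)) 3, σ.points = ![u, p, q, r] :=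
    ⟨⟨_, hg⟩, rfl⟩
  have h := isWellCenteredAtZero_of_circumcenter_mem_interior σ (hM σ ⟨_, hs, hσ ▸ hrange.symm⟩)
  simpa [hσ] using h

/-- A closed triangulated surface `L` cannot be the link of a vertex of a `3`-well-centered mesh
if it has a vertex `b` such that every triangle of `L` without `b` has an edge whose join with
`b` is a triangle of `L`. -/
theorem not_appearsAsLinkInThreeWellCenteredMesh {V : Type*} [Finite V] [DecidableEq V]
    {L : PreAbstractSimplicialComplex V} (b : V) (hne : ∃ t ∈ L.faces, t.card = 3)
    (hadj : ∀ t ∈ L.faces, t.card = 3 → ∀ j ∈ t,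
      ∃ t' ∈ L.faces, t'.card = 3 ∧ t' ≠ t ∧ t.erase j ⊆ t')
    (hb : ∀ t ∈ L.faces, t.card = 3 → b ∉ t →
      ∃ p q r, t = {p, q, r} ∧ ({p, q, b} : Finset V) ∈ L.faces) :
    ¬ AppearsAsLinkInThreeWellCenteredMesh L := by
  classical
  rintro ⟨M, hM, u, -, f, hinj, hf⟩
  have hvert : ∀ t ∈ L.faces, ∀ i ∈ t, i ∈ L.vertexSet := fun t ht i hi =>
    (L.isRelLowerSet_faces ht).2 (Finset.singleton_subset_iff.2 hi) (Finset.singleton_nonempty i)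
  have hinjt : ∀ t ∈ L.faces, Set.InjOn f t := fun t ht => hinj.mono (hvert t ht)
  have hface : ∀ t ∈ L.faces, insert u (t.image f) ∈ M.faces ∧ u ∉ t.image f := by
    intro t ht
    obtain ⟨h1, h2, s, hs, hus, hts⟩ := (hf (t.image f)).2 ⟨t, ht, by simp⟩
    exact ⟨M.down_closed hs (Finset.insert_subset hus hts) (Finset.insert_nonempty _ _), h2⟩
  have hli : ∀ t ∈ L.faces, LinearIndependent ℝ (fun i : t => f i - u) := fun t ht =>
    linearIndependent_sub_of_affineIndependent (hinjt t ht) (hface t ht).2 (M.indep (hface t ht).1)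
  -- A small multiple of a common vector lies in both mesh simplices at `u`, hence in the hull of
  -- their common vertices; rescaling returns to the cones.
  have hinter : ∀ t ∈ L.faces, ∀ t' ∈ L.faces,
      coneOver (fun i => f i - u) t ∩ coneOver (fun i => f i - u) t' ⊆
        coneOver (fun i => f i - u) (t ∩ t') := by
    rintro t ht t' ht' y ⟨hy, hy'⟩
    obtain ⟨r, ⟨h1, h2⟩, hr⟩ := ((eventually_mem_convexHull_of_mem_coneOver hy).and
      (eventually_mem_convexHull_of_mem_coneOver hy')).and self_mem_nhdsWithin |>.exists
    have hr : 0 < r := hr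
    have h3 := M.inter_subset_convexHull (hface t ht).1 (hface t' ht').1
      ⟨by simpa using h1, by simpa using h2⟩
    have hsub : (((insert u (t.image f) : Finset _) : Set (EuclideanSpace ℝ (Fin 3))) ∩
        ((insert u (t'.image f) : Finset _) : Set (EuclideanSpace ℝ (Fin 3)))) ⊆
        insert u (f '' ((t ∩ t' : Finset V) : Set V)) := by
      have h1 := (hface t ht).2
      have h2 := (hface t' ht').2
      rintro z ⟨hz, hz'⟩
      rw [Finset.mem_coe, Finset.mem_insert] at hz hz'
      rcases hz with rfl | hz
      · exact Set.mem_insert _ _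
      rcases hz' with rfl | hz'
      · exact Set.mem_insert _ _
      obtain ⟨i, hi, rfl⟩ := Finset.mem_image.1 hz
      obtain ⟨i', hi', hii'⟩ := Finset.mem_image.1 hz'
      obtain rfl := hinj (hvert t' ht' i' hi') (hvert t ht i hi) hii'
      exact Set.mem_insert_of_mem _ ⟨i', Finset.mem_coe.2 (Finset.mem_inter.2 ⟨hi, hi'⟩), rfl⟩
    have h4 := sub_mem_coneOver_of_mem_convexHull (convexHull_mono hsub h3)
    rw [add_sub_cancel_left] at h4
    have h5 := smul_mem_coneOver h4 (inv_nonneg.2 hr.le)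
    rwa [smul_smul, inv_mul_cancel₀ hr.ne', one_smul] at h5
  have hwc : ∀ p q r : V, ({p, q, r} : Finset V) ∈ L.faces → ({p, q, r} : Finset V).card = 3 →
      IsWellCenteredAtZero (f p - u) (f q - u) (f r - u) := by
    intro p q r ht hcard
    obtain ⟨hpq, hpr, hqr⟩ := ne_of_card_eq_three hcard
    have hi := hinjt _ ht
    obtain ⟨hs, hu⟩ := hface _ ht
    simp only [Finset.image_insert, Finset.image_singleton, Finset.mem_insert,
      Finset.mem_singleton, not_or] at hs hu
    exact isWellCenteredAtZero_of_mem_faces hM hs hu.1 hu.2.1 hu.2.2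
      (fun h => hpq (hi (by simp) (by simp) h)) (fun h => hpr (hi (by simp) (by simp) h))
      (fun h => hqr (hi (by simp) (by simp) h))
  -- By completeness, some cone contains the direction opposite to `b`.
  obtain ⟨t, ⟨ht, htc⟩, hmem⟩ := exists_mem_coneOver_of_fan (v := fun i => f i - u)
    (T := {t | t ∈ L.faces ∧ t.card = 3}) hne (fun t ht => by simpa using ht.2)
    (fun t ht => hli t ht.1) (fun t ht t' ht' => hinter t ht.1 t' ht'.1)
    (fun t ht j hj => by
      obtain ⟨t', h1, h2, h3⟩ := hadj t ht.1 ht.2 j hj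
      exact ⟨t', ⟨h1, h2⟩, h3⟩) (-(f b - u))
  by_cases hbt : b ∈ t
  · obtain ⟨w, hw, heq⟩ := hmem
    -- If `b` is a generator of that cone, uniqueness of coordinates gives `b` the weight `-1`.
    have h1 : ∑ i ∈ t, (if i = b then (-1 : ℝ) else 0) • (f i - u) =
        ∑ i ∈ t, w i • (f i - u) := by
      rw [← heq]; simp [hbt]
    have h2 := eq_of_sum_smul_eq (v := fun i => f i - u) (hli t ht) h1 b hbt
    rw [if_pos rfl] at h2
    linarith [hw b]
  · obtain ⟨p, q, r, rfl, hpq⟩ := hb t ht htc hbt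
    obtain ⟨w, hw, heq⟩ := hmem
    have hne0 : ∀ s ∈ L.faces, ∀ i ∈ s, f i - u ≠ 0 := fun s hs i hi =>
      (hli s hs).ne_zero ⟨i, hi⟩
    have hpq' := ne_of_card_eq_three htc
    have hcard : ({p, q, b} : Finset V).card = 3 := by
      rw [Finset.card_eq_three]
      refine ⟨p, q, b, hpq'.1, ?_, ?_, rfl⟩ <;> rintro rfl <;> simp at hbt
    refine (hwc p q r ht htc).neg_ne (hwc p q b hpq hcard) (hne0 _ ht p (by simp))
      (hne0 _ ht r (by simp)) (hne0 _ hpq b (by simp)) (hw p) (hw q) (hw r) ?_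
    rw [heq, Finset.sum_insert (by simp [hpq'.1, hpq'.2.1]), Finset.sum_pair hpq'.2.2, add_assoc]

end Link

/-! ### Half-space charts on the closed ball, and convex bodies as models. -/

section BallCharts

open EuclideanGeometry TopologicalSpace

local notation "E₃" => EuclideanSpace ℝ (Fin 3)

theorem norm_sq_sub_southPole (x : E₃) :
    dist x (EuclideanSpace.single 0 (-1)) ^ 2 = ‖x‖ ^ 2 + 2 * x 0 + 1 := by
  rw [dist_eq_norm, norm_sub_sq_real, EuclideanSpace.inner_single_right]
  simp

/-- The radius `√2` is the distance from the south pole to the equator: the equator is fixed, so the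
unit sphere goes to the plane where the coordinate `0` vanishes. -/
theorem inversion_southPole_apply_zero (x : E₃) :
    inversion (EuclideanSpace.single 0 (-1) : E₃) √2 x 0 =
      2 / dist x (EuclideanSpace.single 0 (-1)) ^ 2 * (x 0 + 1) - 1 := by
  simp [inversion, div_pow, sub_eq_add_neg, mul_add]

/-- The inversion about the south pole exchanges the closed ball and the closed half-space. -/
theorem inversion_southPole_mem_iff {x : E₃} (hx : x ≠ EuclideanSpace.single 0 (-1)) :
    0 ≤ inversion (EuclideanSpace.single 0 (-1) : E₃) √2 x 0 ↔ x ∈ Metric.closedBall (0 : E₃) 1 := by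
  have hd : 0 < dist x (EuclideanSpace.single 0 (-1) : E₃) ^ 2 := pow_pos (dist_pos.2 hx) 2
  rw [inversion_southPole_apply_zero, mem_closedBall_zero_iff, sub_nonneg, div_mul_eq_mul_div,
    one_le_div hd, norm_sq_sub_southPole, ← sq_le_one_iff₀ (norm_nonneg x)]
  constructor <;> intro h <;> linarith

theorem southPole_notMem {y : E₃} (hy : 0 ≤ y 0) : y ≠ EuclideanSpace.single 0 (-1) := by
  rintro rfl
  simp at hy
  linarith

theorem inversion_southPole_ne {x : E₃} (hx : x ≠ EuclideanSpace.single 0 (-1)) :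
    inversion (EuclideanSpace.single 0 (-1) : E₃) √2 x ≠ EuclideanSpace.single 0 (-1) := by
  rwa [Ne, inversion_eq_center (by positivity)]

/-- The closed ball without its south pole is homeomorphic to the closed half-space. -/
noncomputable def closedBallComplSouthPoleHomeomorph :
    {x : Metric.closedBall (0 : E₃) 1 // x.1 ≠ EuclideanSpace.single 0 (-1)} ≃ₜ
      EuclideanHalfSpace 3 where
  toFun x := ⟨inversion (EuclideanSpace.single 0 (-1)) √2 x.1.1,
    (inversion_southPole_mem_iff x.2).2 x.1.2⟩
  invFun y := ⟨⟨inversion (EuclideanSpace.single 0 (-1)) √2 y.1,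
    (inversion_southPole_mem_iff (inversion_southPole_ne (southPole_notMem y.2))).1
      (by rw [inversion_inversion _ (by positivity)]; exact y.2)⟩,
    inversion_southPole_ne (southPole_notMem y.2)⟩
  left_inv x := Subtype.ext (Subtype.ext (inversion_inversion _ (by positivity) _))
  right_inv y := Subtype.ext (inversion_inversion _ (by positivity) _)
  continuous_toFun := Continuous.subtype_mk (Continuous.inversion continuous_const continuous_const
    (by fun_prop) fun x => x.2) _
  continuous_invFun := Continuous.subtype_mk (Continuous.subtype_mk
    (Continuous.inversion continuous_const continuous_const continuous_subtype_val
      fun y => southPole_notMem y.2) _) _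

theorem nonempty_chartedSpace_of_cover {X H : Type*} [TopologicalSpace X] [TopologicalSpace H]
    (h : ∀ x : X, ∃ e : OpenPartialHomeomorph X H, x ∈ e.source) : Nonempty (ChartedSpace H X) := by
  choose e he using h
  exact ⟨{ atlas := Set.range e
           chartAt := e
           mem_chart_source := he
           chart_mem_atlas := Set.mem_range_self }⟩

theorem nonempty_chartedSpace_of_homeomorph_closedBall {X : Type*} [TopologicalSpace X]
    (e : X ≃ₜ Metric.closedBall (0 : E₃) 1) : Nonempty (ChartedSpace (EuclideanHalfSpace 3) X) := by
  have hchart : ∀ x : Metric.closedBall (0 : E₃) 1, x.1 ≠ EuclideanSpace.single 0 (-1) →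
      ∃ φ : OpenPartialHomeomorph (Metric.closedBall (0 : E₃) 1) (EuclideanHalfSpace 3),
        x ∈ φ.source := by
    intro x hx
    let O : Opens (Metric.closedBall (0 : E₃) 1) :=
      ⟨{x | x.1 ≠ EuclideanSpace.single 0 (-1)}, isOpen_ne_fun continuous_subtype_val
        continuous_const⟩
    have : Nonempty O := ⟨⟨x, hx⟩⟩
    refine ⟨(O.openPartialHomeomorphSubtypeCoe this).symm.transHomeomorph
      closedBallComplSouthPoleHomeomorph, ?_⟩
    simpa [O] using hx
  -- The antipodal map moves the south pole into the domain of the one available chart.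
  let ν : Metric.closedBall (0 : E₃) 1 ≃ₜ Metric.closedBall (0 : E₃) 1 :=
    (Homeomorph.neg E₃).subtype fun x => by simp
  refine nonempty_chartedSpace_of_cover fun x => ?_
  by_cases hx : (e x).1 = EuclideanSpace.single 0 (-1)
  · obtain ⟨φ, hφ⟩ := hchart (ν (e x)) (by
      change -(e x).1 ≠ _
      rw [hx]
      intro h
      have := congrArg (fun y : E₃ => y 0) h
      simp at this
      linarith)
    exact ⟨(e.trans ν).transOpenPartialHomeomorph φ, by simpa using hφ⟩
  · obtain ⟨φ, hφ⟩ := hchart (e x) hx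
    exact ⟨e.transOpenPartialHomeomorph φ, by simpa using hφ⟩

/-- A continuous injective map on a compact set is a homeomorphism onto its image. -/
theorem nonempty_homeomorph_image {X Y : Type*} [TopologicalSpace X] [TopologicalSpace Y]
    [T2Space Y] {S : Set X} (hS : IsCompact S) {Φ : X → Y} (hc : ContinuousOn Φ S)
    (hi : Set.InjOn Φ S) : Nonempty (S ≃ₜ Φ '' S) := by
  have := isCompact_iff_compactSpace.1 hS
  have hcont : Continuous (Equiv.Set.imageOfInjOn Φ S hi) :=
    Continuous.subtype_mk hc.domRestrict _
  exact ⟨hcont.homeoOfEquivCompactToT2⟩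

/-- A complex whose realization is parametrized by a convex body, the realization of `L` being the
image of the boundary of the body. -/
theorem isTriangulationOfS2_and_isThreeManifoldComplex {F : Type*} [NormedAddCommGroup F]
    [NormedSpace ℝ F] [FiniteDimensional ℝ F] (hF : Module.finrank ℝ F = 3) {V : Type*} [Fintype V]
    {K L : PreAbstractSimplicialComplex V} {S : Set F} (hconv : Convex ℝ S) (hcpt : IsCompact S)
    (hne : (interior S).Nonempty) {Φ : F → V → ℝ} (hc : ContinuousOn Φ S) (hi : Set.InjOn Φ S)
    (hK : Φ '' S = K.realization) (hL : Φ '' frontier S = L.realization) :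
    L.IsTriangulationOfS2 ∧ K.IsThreeManifoldComplex := by
  let A : F ≃L[ℝ] E₃ := ContinuousLinearEquiv.ofFinrankEq (by simpa using hF)
  let A' : F ≃ₜ E₃ := A.toHomeomorph
  have hne' : (interior (A' '' S)).Nonempty := by
    rw [← A'.image_interior]; exact hne.image _
  -- A homeomorphism of the whole space carries the body to the unit ball and its frontier to the
  -- sphere, so one map handles both claims.
  obtain ⟨h, -, h2, h3⟩ := exists_homeomorph_image_interior_closure_frontier_eq_unitBall
    (hconv.linear_image A.toLinearMap : Convex ℝ (A' '' S)) hne'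
    (hcpt.image A'.continuous).isBounded
  change h '' closure (A' '' S) = _ at h2
  change h '' frontier (A' '' S) = _ at h3
  rw [(hcpt.image A'.continuous).isClosed.closure_eq, ← Set.image_comp] at h2
  rw [← A'.image_frontier, ← Set.image_comp] at h3
  have hfS : frontier S ⊆ S := hcpt.isClosed.frontier_subset
  have hfc : IsCompact (frontier S) := hcpt.of_isClosed_subset isClosed_frontier hfS
  obtain ⟨eK⟩ := nonempty_homeomorph_image hcpt hc hi
  obtain ⟨eL⟩ := nonempty_homeomorph_image hfc (hc.mono hfS) (hi.mono hfS)
  let g : F ≃ₜ E₃ := A'.trans h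
  constructor
  · exact ⟨(Homeomorph.setCongr hL.symm).trans (eL.symm.trans ((g.image (frontier S)).trans
      (Homeomorph.setCongr h3)))⟩
  · exact nonempty_chartedSpace_of_homeomorph_closedBall ((Homeomorph.setCongr hK.symm).trans
      (eK.symm.trans ((g.image S).trans (Homeomorph.setCongr h2))))

end BallCharts

/-! ### The case of four vertices. -/

section SingleTetrahedron

namespace PreAbstractSimplicialComplex

theorem mem_faces_boundary_top_iff {s : Finset (Fin 4)} :
    s ∈ (⊤ : PreAbstractSimplicialComplex (Fin 4)).boundary.faces ↔
      s.Nonempty ∧ s ≠ Finset.univ := by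
  constructor
  · rintro ⟨hs, t, -, hst, ht, -⟩
    refine ⟨hs, ?_⟩
    rintro rfl
    have := Finset.card_le_card hst
    simp [ht] at this
  · rintro ⟨hs, hne⟩
    obtain ⟨v, hv⟩ : ∃ v, v ∉ s := by
      by_contra! h
      exact hne (Finset.eq_univ_iff_forall.2 h)
    have hc : (Finset.univ.erase v).card = 3 := by simp
    refine ⟨hs, Finset.univ.erase v, Finset.card_pos.1 (by omega), fun i hi => ?_, hc,
      Finset.univ, ⟨Finset.univ_nonempty, by simp, Finset.subset_univ _⟩, ?_⟩
    · exact Finset.mem_erase.2 ⟨ne_of_mem_of_not_mem hi hv, Finset.mem_univ i⟩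
    · rintro σ ⟨-, hσ, -⟩
      exact Finset.card_eq_iff_eq_univ _ |>.1 (by simpa using hσ)

theorem isSingleTetrahedron_top : (⊤ : PreAbstractSimplicialComplex (Fin 4)).IsSingleTetrahedron :=
  ⟨Finset.univ, by simp, fun s => by
    simp only [Finset.subset_univ, and_true]
    exact Iff.rfl⟩

theorem isIsomorphic_refl {V : Type*} (K : PreAbstractSimplicialComplex V) : K.IsIsomorphic K :=
  ⟨id, Set.injOn_id _, fun t => by simp⟩

theorem realization_top : (⊤ : PreAbstractSimplicialComplex (Fin 4)).realization =
    {x | (∀ v, 0 ≤ x v) ∧ ∑ v, x v = 1} := by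
  ext x
  refine ⟨fun h => ⟨h.1, h.2.1⟩, fun h => ⟨h.1, h.2, Finset.univ, Finset.univ_nonempty, by simp⟩⟩

theorem realization_boundary_top :
    (⊤ : PreAbstractSimplicialComplex (Fin 4)).boundary.realization =
      {x | (∀ v, 0 ≤ x v) ∧ ∑ v, x v = 1 ∧ ∃ v, x v = 0} := by
  ext x
  constructor
  · rintro ⟨h1, h2, s, hs, h3⟩
    obtain ⟨v, hv⟩ : ∃ v, v ∉ s := by
      by_contra! h
      exact (mem_faces_boundary_top_iff.1 hs).2 (Finset.eq_univ_iff_forall.2 h)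
    exact ⟨h1, h2, v, h3 v hv⟩
  · rintro ⟨h1, h2, v, hv⟩
    refine ⟨h1, h2, Finset.univ.erase v, mem_faces_boundary_top_iff.2 ⟨Finset.card_pos.1 (by simp),
      fun h => ?_⟩, fun i hi => ?_⟩
    · simpa [h] using Finset.notMem_erase v Finset.univ
    · obtain rfl : i = v := by simpa using hi
      exact hv

/-- The barycentric coordinates with respect to the standard simplex of `ℝ³`. -/
def cornerBarycentric (y : Fin 3 → ℝ) : Fin 4 → ℝ := Fin.cons (1 - ∑ i, y i) y

theorem cornerBarycentric_combo (y z : Fin 3 → ℝ) {a b : ℝ} (hab : a + b = 1) :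
    cornerBarycentric (a • y + b • z) = a • cornerBarycentric y + b • cornerBarycentric z := by
  funext i
  refine Fin.cases ?_ (fun i => ?_) i
  · simp only [cornerBarycentric, Fin.cons_zero, Pi.add_apply, Pi.smul_apply, smul_eq_mul,
      Finset.sum_add_distrib, ← Finset.mul_sum]
    linear_combination -hab
  · simp [cornerBarycentric]

theorem continuous_cornerBarycentric : Continuous cornerBarycentric :=
  continuous_pi fun i => by
    refine Fin.cases ?_ (fun i => ?_) i
    · simp only [cornerBarycentric, Fin.cons_zero]; fun_prop
    · simp only [cornerBarycentric, Fin.cons_succ]; fun_prop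

theorem sum_cornerBarycentric (y : Fin 3 → ℝ) : ∑ i, cornerBarycentric y i = 1 := by
  rw [Fin.sum_univ_succ]; simp [cornerBarycentric]

theorem eq_cornerBarycentric {x : Fin 4 → ℝ} (hx : ∑ i, x i = 1) :
    cornerBarycentric (fun i => x i.succ) = x := by
  funext i
  refine Fin.cases ?_ (fun i => ?_) i
  · rw [Fin.sum_univ_succ] at hx
    simp only [cornerBarycentric, Fin.cons_zero]; linarith
  · simp [cornerBarycentric]

theorem interior_cornerBarycentric_nonneg :
    interior {y | ∀ i, 0 ≤ cornerBarycentric y i} = {y | ∀ i, 0 < cornerBarycentric y i} := by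
  apply subset_antisymm
  · intro y hy i
    -- An interior point may be pushed slightly away from the barycenter without leaving the
    -- simplex; this is impossible if a coordinate is zero, since every barycentric coordinate of
    -- the barycenter is `1/4`.
    have hc : Continuous fun r : ℝ => (1 + r) • y + (-r) • fun _ : Fin 3 => (1 / 4 : ℝ) := by
      fun_prop
    have h0 : ∀ᶠ r : ℝ in nhdsWithin 0 (Set.Ioi 0),
        (1 + r) • y + (-r) • (fun _ : Fin 3 => (1 / 4 : ℝ)) ∈
        interior {y | ∀ i, 0 ≤ cornerBarycentric y i} := by
      refine Filter.Eventually.filter_mono nhdsWithin_le_nhds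
        (hc.continuousAt.eventually_mem (isOpen_interior.mem_nhds ?_))
      simpa using hy
    obtain ⟨r, hr, hr0⟩ := (h0.and self_mem_nhdsWithin).exists
    have hr0 : 0 < r := hr0
    have h1 := interior_subset hr i
    rw [cornerBarycentric_combo _ _ (by ring)] at h1
    have h2 : cornerBarycentric (fun _ : Fin 3 => (1 / 4 : ℝ)) i = 1 / 4 := by
      refine Fin.cases ?_ (fun i => ?_) i
      · simp only [cornerBarycentric, Fin.cons_zero]; norm_num
      · simp [cornerBarycentric]
    simp only [Pi.add_apply, Pi.smul_apply, smul_eq_mul, h2] at h1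
    by_contra! hneg
    nlinarith
  · refine interior_maximal (fun y hy i => (hy i).le) ?_
    simp only [Set.ofPred_forall]
    exact isOpen_iInter_of_finite fun i => isOpen_lt continuous_const
      ((continuous_apply i).comp continuous_cornerBarycentric)

theorem isClosed_cornerBarycentric_nonneg : IsClosed {y | ∀ i, 0 ≤ cornerBarycentric y i} := by
  simp only [Set.ofPred_forall]
  exact isClosed_iInter fun i => isClosed_le continuous_const
      ((continuous_apply i).comp continuous_cornerBarycentric)

theorem isTriangulationOfS2_boundary_top_and_isThreeManifoldComplex_top :
    (⊤ : PreAbstractSimplicialComplex (Fin 4)).boundary.IsTriangulationOfS2 ∧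
      (⊤ : PreAbstractSimplicialComplex (Fin 4)).IsThreeManifoldComplex := by
  refine isTriangulationOfS2_and_isThreeManifoldComplex (F := Fin 3 → ℝ) (by simp)
    (S := {y | ∀ i, 0 ≤ cornerBarycentric y i}) (Φ := cornerBarycentric) ?_ ?_ ?_
    continuous_cornerBarycentric.continuousOn ?_ ?_ ?_
  · intro y hy z hz a b ha hb hab i
    rw [cornerBarycentric_combo _ _ hab]
    exact add_nonneg (mul_nonneg ha (hy i)) (mul_nonneg hb (hz i))
  · refine Metric.isCompact_of_isClosed_isBounded isClosed_cornerBarycentric_nonneg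
      ((Metric.isBounded_Icc (0 : Fin 3 → ℝ) 1).subset fun y hy => ⟨fun i => ?_, fun i => ?_⟩)
    · simpa [cornerBarycentric] using hy i.succ
    · have h0 := hy 0
      simp only [cornerBarycentric, Fin.cons_zero] at h0
      have := Finset.single_le_sum (f := y) (fun j _ => by
        simpa [cornerBarycentric] using hy j.succ) (Finset.mem_univ i)
      simp only [Pi.one_apply]; linarith
  · rw [interior_cornerBarycentric_nonneg]
    refine ⟨fun _ => 1 / 4, fun i => ?_⟩
    refine Fin.cases ?_ (fun i => ?_) i
    · simp only [cornerBarycentric, Fin.cons_zero]; norm_num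
    · simp [cornerBarycentric]
  · intro y _ z _ h
    exact (Fin.cons_inj.1 h).2
  · rw [realization_top]
    ext x
    constructor
    · rintro ⟨y, hy, rfl⟩
      exact ⟨hy, sum_cornerBarycentric y⟩
    · rintro ⟨h1, h2⟩
      refine ⟨fun i => x i.succ, ?_, eq_cornerBarycentric h2⟩
      simpa only [Set.mem_ofPred_eq, eq_cornerBarycentric h2] using h1
  · rw [realization_boundary_top, isClosed_cornerBarycentric_nonneg.frontier_eq,
      interior_cornerBarycentric_nonneg]
    ext x
    constructor
    · rintro ⟨y, ⟨hy, hy'⟩, rfl⟩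
      simp only [Set.mem_ofPred_eq, not_forall, not_lt] at hy'
      obtain ⟨i, hi⟩ := hy'
      exact ⟨hy, sum_cornerBarycentric y, i, le_antisymm hi (hy i)⟩
    · rintro ⟨h1, h2, i, hi⟩
      refine ⟨fun i => x i.succ, ⟨?_, fun h => ?_⟩, eq_cornerBarycentric h2⟩
      · simpa only [Set.mem_ofPred_eq, eq_cornerBarycentric h2] using h1
      · simp only [Set.mem_ofPred_eq, eq_cornerBarycentric h2] at h
        exact absurd hi (h i).ne'

theorem isOneRingCertificate_top : (⊤ : PreAbstractSimplicialComplex (Fin 4)).IsOneRingCertificate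
    (⊤ : PreAbstractSimplicialComplex (Fin 4)).boundary where
  dimension := ⟨⟨Finset.univ, Finset.univ_nonempty, by simp⟩, fun s _ => s.card_le_univ⟩
  manifold := isTriangulationOfS2_boundary_top_and_isThreeManifoldComplex_top.2
  boundary_iso := isIsomorphic_refl _
  two_facets := by
    intro σ _ hσ
    obtain rfl : σ = Finset.univ := Finset.card_eq_iff_eq_univ _ |>.1 (by simpa using hσ)
    have hmem : ∀ v : Fin 4, Finset.univ.erase v ∈
        {τ : Finset (Fin 4) | τ ∈ (⊤ : PreAbstractSimplicialComplex (Fin 4)).boundary.faces ∧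
          τ.card = 3 ∧ τ ⊆ Finset.univ} := fun v =>
      ⟨mem_faces_boundary_top_iff.2 ⟨Finset.card_pos.1 (by simp), fun h => by
        simpa [h] using Finset.notMem_erase v Finset.univ⟩, by simp, Finset.subset_univ _⟩
    refine (Set.one_lt_ncard (Set.toFinite _)).2 ⟨_, hmem 0, _, hmem 1, by decide⟩

theorem not_appearsAsLink_boundary_top : ¬ AppearsAsLinkInThreeWellCenteredMesh
    (⊤ : PreAbstractSimplicialComplex (Fin 4)).boundary := by
  refine not_appearsAsLinkInThreeWellCenteredMesh 0 ⟨{0, 1, 2}, ?_, by decide⟩ ?_ ?_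
  · exact mem_faces_boundary_top_iff.2 (by decide)
  · simp only [mem_faces_boundary_top_iff]; decide
  -- The only triangle avoiding `0` is `{1, 2, 3}`.
  · intro t ht htc h0
    refine ⟨1, 2, 3, ?_, mem_faces_boundary_top_iff.2 (by decide)⟩
    clear ht
    revert t; decide

end PreAbstractSimplicialComplex

end SingleTetrahedron

/-! ### Piecewise linear coordinates on a circle cut into `k` arcs. -/

section CycleParametrization

theorem zmod_one_ne_zero {k : ℕ} (hk : 3 ≤ k) : (1 : ZMod k) ≠ 0 := by
  have : Fact (1 < k) := ⟨by omega⟩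
  exact one_ne_zero

theorem zmod_two_ne_zero {k : ℕ} (hk : 3 ≤ k) : (2 : ZMod k) ≠ 0 := by
  intro h
  have h2 : ((2 : ℕ) : ZMod k) = 0 := by exact_mod_cast h
  have := Nat.le_of_dvd (by norm_num) ((ZMod.natCast_eq_zero_iff 2 k).1 h2)
  omega

/-- The hat functions of the subdivision of the circle into `k` equal arcs. -/
noncomputable def circleHat {k : ℕ} [NeZero k] (θ : UnitAddCircle) (i : ZMod k) : ℝ :=
  max 0 (1 - k * ‖θ - ZMod.toAddCircle i‖)

theorem circleHat_nonneg {k : ℕ} [NeZero k] (θ : UnitAddCircle) (i : ZMod k) :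
    0 ≤ circleHat θ i := le_max_left _ _

theorem circleHat_le_one {k : ℕ} [NeZero k] (θ : UnitAddCircle) (i : ZMod k) :
    circleHat θ i ≤ 1 :=
  max_le zero_le_one (sub_le_self _ (mul_nonneg (Nat.cast_nonneg k) (norm_nonneg _)))

theorem continuous_circleHat {k : ℕ} [NeZero k] (i : ZMod k) :
    Continuous fun θ : UnitAddCircle => circleHat θ i := by
  unfold circleHat; fun_prop

/-- The point of the circle at parameter `t` on the arc from `i` to `i + 1`. -/
noncomputable def arcPoint {k : ℕ} [NeZero k] (i : ZMod k) (t : ℝ) : UnitAddCircle :=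
  ZMod.toAddCircle i + ((t / k : ℝ) : UnitAddCircle)

/-- For a lift `y`, take the floor and fractional part of `k * y`. The strict bound `t < 1` keeps
the hat at `i` positive, which injectivity needs. -/
theorem exists_eq_arcPoint (k : ℕ) [NeZero k] (θ : UnitAddCircle) :
    ∃ (i : ZMod k) (t : ℝ), 0 ≤ t ∧ t < 1 ∧ θ = arcPoint i t := by
  obtain ⟨y, rfl⟩ := QuotientAddGroup.mk_surjective θ
  have hk : (k : ℝ) ≠ 0 := Nat.cast_ne_zero.2 (NeZero.ne k)
  refine ⟨(⌊k * y⌋ : ℤ), Int.fract (k * y), Int.fract_nonneg _, Int.fract_lt_one _, ?_⟩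
  rw [arcPoint, ZMod.toAddCircle_intCast, ← AddCircle.coe_add, ← add_div, Int.floor_add_fract,
    mul_div_cancel_left₀ _ hk]

theorem norm_coe_of_mem {x : ℝ} (h0 : 0 ≤ x) (h1 : x ≤ 1 / 2) : ‖(x : UnitAddCircle)‖ = x := by
  have := (AddCircle.norm_coe_eq_abs_iff (p := (1 : ℝ)) (x := x) one_ne_zero).2
    (by rwa [abs_of_nonneg h0, abs_one])
  rw [this, abs_of_nonneg h0]

/-- The norm is the distance to the nearest integer, which is at most `0` or at least `1`. -/
theorem le_norm_coe {x d : ℝ} (h0 : d ≤ x) (h1 : x ≤ 1 - d) : d ≤ ‖(x : UnitAddCircle)‖ := by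
  rw [UnitAddCircle.norm_eq]
  rcases le_or_gt (round x) 0 with h | h
  · have : (round x : ℝ) ≤ 0 := by exact_mod_cast h
    exact le_trans (by linarith) (le_abs_self _)
  · have : (1 : ℝ) ≤ round x := by exact_mod_cast h
    exact le_trans (by linarith) (neg_le_abs _)

variable {k : ℕ} [NeZero k]

theorem circleHat_arcPoint_self (hk : 3 ≤ k) (i : ZMod k) {t : ℝ} (h0 : 0 ≤ t) (h1 : t ≤ 1) :
    circleHat (arcPoint i t) i = 1 - t := by
  have hk' : (3 : ℝ) ≤ k := by exact_mod_cast hk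
  rw [circleHat, arcPoint, add_sub_cancel_left, norm_coe_of_mem (by positivity)
    (by rw [div_le_iff₀ (by linarith)]; linarith), mul_div_cancel₀ _ (by linarith),
    max_eq_right (by linarith)]

theorem toAddCircle_one : ZMod.toAddCircle (1 : ZMod k) = ((1 / k : ℝ) : UnitAddCircle) := by
  have := ZMod.toAddCircle_natCast (N := k) 1
  simpa using this

theorem circleHat_arcPoint_succ (hk : 3 ≤ k) (i : ZMod k) {t : ℝ} (h0 : 0 ≤ t) (h1 : t ≤ 1) :
    circleHat (arcPoint i t) (i + 1) = t := by
  have hk' : (3 : ℝ) ≤ k := by exact_mod_cast hk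
  have h2 : arcPoint i t - ZMod.toAddCircle (i + 1) = -(((1 - t) / k : ℝ) : UnitAddCircle) := by
    rw [arcPoint, map_add, toAddCircle_one, add_sub_add_left_eq_sub, sub_div, AddCircle.coe_sub,
      neg_sub]
  rw [circleHat, h2, norm_neg, norm_coe_of_mem (div_nonneg (by linarith) (by linarith))
    (by rw [div_le_iff₀ (by linarith)]; linarith), mul_div_cancel₀ _ (by linarith), sub_sub_cancel,
    max_eq_right h0]

theorem circleHat_arcPoint_of_ne {i j : ZMod k} (hj : j ≠ i) (hj' : j ≠ i + 1) {t : ℝ}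
    (h0 : 0 ≤ t) (h1 : t ≤ 1) : circleHat (arcPoint i t) j = 0 := by
  have hk : (0 : ℝ) < k := Nat.cast_pos.2 (NeZero.pos k)
  -- The representative of `i - j` lies between `1` and `k - 2`, so the point stays at distance at
  -- least `1 / k` from the node `j`.
  set l := i - j with hl
  have hl0 : 1 ≤ l.val := Nat.one_le_iff_ne_zero.2 fun h =>
    hj (sub_eq_zero.1 ((ZMod.val_eq_zero _).1 h)).symm
  have hl1 : l.val + 2 ≤ k := by
    have := ZMod.val_lt l
    by_contra! hlt
    have h3 : l.val + 1 = k := by omega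
    have h4 : l + 1 = 0 := by
      rw [← ZMod.natCast_zmod_val l, ← Nat.cast_one, ← Nat.cast_add, h3, ZMod.natCast_self]
    exact hj' (by rw [hl] at h4; linear_combination -h4)
  have h2 : arcPoint i t - ZMod.toAddCircle j = (((l.val + t) / k : ℝ) : UnitAddCircle) := by
    rw [arcPoint, add_sub_right_comm, ← map_sub, ← hl, ZMod.toAddCircle_apply, ← AddCircle.coe_add,
      add_div]
  have h3 : (1 : ℝ) ≤ l.val := by exact_mod_cast hl0
  have h4 : (l.val : ℝ) + 2 ≤ k := by exact_mod_cast hl1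
  have h5 : 1 / (k : ℝ) ≤ ‖arcPoint i t - ZMod.toAddCircle j‖ := by
    rw [h2]
    apply le_norm_coe
    · gcongr; linarith
    · rw [one_sub_div hk.ne']; gcongr; linarith
  rw [div_le_iff₀ hk] at h5
  rw [circleHat, max_eq_left (by linarith)]

theorem sum_eq_add_of_eq_zero (hk : 3 ≤ k) {g : ZMod k → ℝ} {i : ZMod k}
    (h : ∀ j, j ≠ i → j ≠ i + 1 → g j = 0) : ∑ j, g j = g i + g (i + 1) := by
  have hne : i ≠ i + 1 := fun h => zmod_one_ne_zero hk (left_eq_add.1 h)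
  rw [← Finset.sum_pair hne]
  refine (Finset.sum_subset (Finset.subset_univ _) fun j _ hj => ?_).symm
  simp only [Finset.mem_insert, Finset.mem_singleton, not_or] at hj
  exact h j hj.1 hj.2

theorem sum_circleHat (hk : 3 ≤ k) (θ : UnitAddCircle) : ∑ i : ZMod k, circleHat θ i = 1 := by
  obtain ⟨i, t, h0, h1, rfl⟩ := exists_eq_arcPoint k θ
  rw [sum_eq_add_of_eq_zero hk fun j hj hj' => circleHat_arcPoint_of_ne hj hj' h0 h1.le,
    circleHat_arcPoint_self hk i h0 h1.le, circleHat_arcPoint_succ hk i h0 h1.le]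
  ring

/-- A point on the half-open arc `i` has positive hat at `i`. Points on different arcs are separated
by one of the two starting nodes, because `i = i' + 1` and `i' = i + 1` cannot both hold when `k ≥
3`. -/
theorem circleHat_injective (hk : 3 ≤ k) :
    Function.Injective (circleHat : UnitAddCircle → ZMod k → ℝ) := by
  intro θ θ' h
  obtain ⟨i, t, h0, h1, rfl⟩ := exists_eq_arcPoint k θ
  obtain ⟨i', t', h0', h1', rfl⟩ := exists_eq_arcPoint k θ'
  have e1 := congrFun h i
  have e2 := congrFun h i'
  rw [circleHat_arcPoint_self hk i h0 h1.le] at e1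
  rw [circleHat_arcPoint_self hk i' h0' h1'.le] at e2
  by_cases hii : i = i'
  · subst hii
    rw [circleHat_arcPoint_self hk i h0' h1'.le] at e1
    rw [show t = t' by linarith]
  · exfalso
    by_cases hi : i = i' + 1
    · have : i' ≠ i + 1 := fun h' => zmod_two_ne_zero hk (by
        rw [h'] at hi; linear_combination -hi)
      rw [circleHat_arcPoint_of_ne (Ne.symm hii) this h0 h1.le] at e2
      linarith
    · rw [circleHat_arcPoint_of_ne hii hi h0' h1'.le] at e1
      linarith

/-- The argument of a complex number as a point of the circle `ℝ / ℤ`. -/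
noncomputable def circleArg (z : ℂ) : UnitAddCircle :=
  AddCircle.homeomorphAddCircle (2 * Real.pi) 1 (by positivity) one_ne_zero
    (Complex.arg z : Real.Angle)

theorem continuousAt_circleArg {z : ℂ} (hz : z ≠ 0) : ContinuousAt circleArg z :=
  (Homeomorph.continuous _).continuousAt.comp (Complex.continuousAt_arg_coe_angle hz)

theorem eq_of_norm_eq_of_circleArg_eq {z w : ℂ} (h : ‖z‖ = ‖w‖) (h' : circleArg z = circleArg w) :
    z = w :=
  Complex.ext_norm_arg h (Complex.arg_coe_angle_eq_iff.1 ((Homeomorph.injective _) h'))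

theorem exists_norm_eq_circleArg_eq {r : ℝ} (hr : 0 < r) (θ : UnitAddCircle) :
    ∃ z : ℂ, ‖z‖ = r ∧ circleArg z = θ := by
  obtain ⟨φ, rfl⟩ := (AddCircle.homeomorphAddCircle (2 * Real.pi) (1 : ℝ) (by positivity)
    one_ne_zero).surjective θ
  refine ⟨r * (Real.Angle.cos φ + Real.Angle.sin φ * Complex.I), ?_, ?_⟩
  · induction φ using Real.Angle.induction_on with | h x => ?_
    rw [Real.Angle.cos_coe, Real.Angle.sin_coe, norm_mul, Complex.ofReal_cos, Complex.ofReal_sin,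
      Complex.norm_cos_add_sin_mul_I, mul_one, Complex.norm_real, Real.norm_of_nonneg hr.le]
  · exact congrArg _ (Complex.arg_mul_cos_add_sin_mul_I_coe_angle hr φ)

/-- At the origin the argument is a discontinuous default value, but the hat is bounded and the
factor `‖z‖` tends to zero. -/
theorem continuous_norm_mul_circleHat (i : ZMod k) :
    Continuous fun z : ℂ => ‖z‖ * circleHat (circleArg z) i := by
  rw [continuous_iff_continuousAt]
  intro z
  by_cases hz : z = 0
  · subst hz
    rw [ContinuousAt, norm_zero, zero_mul]
    refine squeeze_zero (fun z => mul_nonneg (norm_nonneg z) (circleHat_nonneg _ _))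
      (fun z => mul_le_of_le_one_right (norm_nonneg z) (circleHat_le_one _ _)) ?_
    simpa using (continuous_norm (E := ℂ)).tendsto 0
  · exact continuous_norm.continuousAt.mul
      ((continuous_circleHat i).continuousAt.comp (continuousAt_circleArg hz))

end CycleParametrization

theorem zmod_succ_ne {k : ℕ} (hk : 3 ≤ k) (i : ZMod k) : i + 1 ≠ i := fun e =>
  zmod_one_ne_zero hk (add_eq_left.1 e)

theorem zmod_succ_succ_ne {k : ℕ} (hk : 3 ≤ k) (i : ZMod k) : i + 1 + 1 ≠ i := fun e =>
  zmod_two_ne_zero hk (by linear_combination e)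

/-! ### Combinatorics of tetrahedra around an edge. -/

section Bipyramid

namespace PreAbstractSimplicialComplex

variable {V : Type*} [DecidableEq V] {k : ℕ}

/-- The complex of the tetrahedra `a b c_i c_{i+1}` and their faces. -/
def aroundEdge (a b : V) (c : ZMod k → V) : PreAbstractSimplicialComplex V where
  faces := {s | s.Nonempty ∧ ∃ i : ZMod k, s ⊆ {a, b, c i, c (i + 1)}}
  isRelLowerSet_faces := by
    rintro s ⟨hs, i, hi⟩
    exact ⟨hs, fun s' hs' hne => ⟨hne, i, hs'.trans hi⟩⟩

theorem tetrahedron_mem_aroundEdge (a b : V) (c : ZMod k → V) (i : ZMod k) :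
    ({a, b, c i, c (i + 1)} : Finset V) ∈ (aroundEdge a b c).faces :=
  ⟨Finset.insert_nonempty _ _, i, subset_rfl⟩

/-- The vertices `a`, `b`, `c i` are pairwise distinct and there are no others. -/
structure IsEdgeRingLabelling (a b : V) (c : ZMod k → V) : Prop where
  three_le : 3 ≤ k
  ne : a ≠ b
  injective : Function.Injective c
  ne_left : ∀ i, c i ≠ a
  ne_right : ∀ i, c i ≠ b
  exhaust : ∀ v, v = a ∨ v = b ∨ ∃ i, v = c i

namespace IsEdgeRingLabelling

variable {a b : V} {c : ZMod k → V} (h : IsEdgeRingLabelling a b c)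

include h

theorem isTetrahedraAroundEdge : (aroundEdge a b c).IsTetrahedraAroundEdge k := by
  refine ⟨h.three_le, a, b, c, h.ne, h.injective, h.ne_left, h.ne_right, fun s => ?_⟩
  refine and_congr Iff.rfl (exists_congr fun i => ?_)
  rw [← Finset.coe_subset]
  simp

omit [DecidableEq V] in
theorem ring_ne (i : ZMod k) : c i ≠ c (i + 1) := fun e =>
  zmod_succ_ne h.three_le i (h.injective e).symm

theorem card_tetrahedron (i : ZMod k) : ({a, b, c i, c (i + 1)} : Finset V).card = 4 := by
  have := h.ne
  have := h.ne_left i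
  have := h.ne_left (i + 1)
  have := h.ne_right i
  have := h.ne_right (i + 1)
  have := h.ring_ne i
  rw [Finset.card_insert_of_notMem, Finset.card_insert_of_notMem, Finset.card_pair] <;> grind

theorem card_triangle {x : V} (hx : x = a ∨ x = b) (i : ZMod k) :
    ({x, c i, c (i + 1)} : Finset V).card = 3 := by
  have := h.ne_left i
  have := h.ne_left (i + 1)
  have := h.ne_right i
  have := h.ne_right (i + 1)
  have := h.ring_ne i
  rw [Finset.card_insert_of_notMem, Finset.card_pair] <;> grind

theorem eq_tetrahedron {σ : Finset V} (hσ : σ ∈ (aroundEdge a b c).faces) (hc : σ.card = 4) :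
    ∃ i, σ = {a, b, c i, c (i + 1)} := by
  obtain ⟨-, i, hi⟩ := hσ
  exact ⟨i, Finset.eq_of_subset_of_card_le hi (by rw [h.card_tetrahedron, hc])⟩

theorem mem_tetrahedron_iff (i j : ZMod k) :
    c i ∈ ({a, b, c j, c (j + 1)} : Finset V) ↔ i = j ∨ i = j + 1 := by
  simp [h.ne_left, h.ne_right, h.injective.eq_iff]

/-- A triangle containing both `a` and `b` is `a b c_j`, shared by the tetrahedra `j - 1` and `j`,
hence interior. A triangle on `c_i c_{i+1}` determines `i`, since `k ≥ 3`, and so lies in one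
tetrahedron only. -/
theorem mem_faces_boundary_iff {s : Finset V} : s ∈ (aroundEdge a b c).boundary.faces ↔
    s.Nonempty ∧ ∃ x, (x = a ∨ x = b) ∧ ∃ i, s ⊆ {x, c i, c (i + 1)} := by
  constructor
  · rintro ⟨hs, t, ⟨-, i, hti⟩, hst, htc, hu⟩
    refine ⟨hs, ?_⟩
    by_cases hat : a ∈ t
    swap
    · exact ⟨b, Or.inr rfl, i, hst.trans ((Finset.subset_insert_iff_of_notMem hat).1 hti)⟩
    by_cases hbt : b ∈ t
    swap
    · refine ⟨a, Or.inl rfl, i, hst.trans ?_⟩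
      rw [Finset.insert_comm] at hti
      exact (Finset.subset_insert_iff_of_notMem hbt).1 hti
    exfalso
    obtain ⟨j, hj⟩ : ∃ j, t ⊆ {a, b, c j} := by
      by_cases h1 : c i ∈ t
      · refine ⟨i, ?_⟩
        by_cases h2 : c (i + 1) ∈ t
        · have := Finset.card_le_card (s := {a, b, c i, c (i + 1)}) (t := t) (by
            simp [Finset.insert_subset_iff, hat, hbt, h1, h2])
          rw [h.card_tetrahedron] at this
          omega
        · intro x hx
          have := hti hx
          grind
      · refine ⟨i + 1, ?_⟩
        intro x hx
        have := hti hx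
        grind
    have h1 := hu.unique ⟨tetrahedron_mem_aroundEdge a b c j, h.card_tetrahedron j, fun x hx => by
      have := hj hx; grind⟩
      ⟨tetrahedron_mem_aroundEdge a b c (j - 1), h.card_tetrahedron (j - 1), fun x hx => by
      have := hj hx; rw [sub_add_cancel]; grind⟩
    have h2 : c (j + 1) ∈ ({a, b, c (j - 1), c (j - 1 + 1)} : Finset V) := by
      rw [← h1, h.mem_tetrahedron_iff]; exact Or.inr rfl
    rw [h.mem_tetrahedron_iff] at h2
    rcases h2 with h2 | h2
    · exact zmod_succ_succ_ne h.three_le (j - 1) (by rw [sub_add_cancel]; exact h2)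
    · exact zmod_succ_ne h.three_le j (by rw [h2, sub_add_cancel])
  · rintro ⟨hs, x, hx, i, hsi⟩
    refine ⟨hs, {x, c i, c (i + 1)}, ⟨Finset.insert_nonempty _ _, i, ?_⟩, hsi,
      h.card_triangle hx i, {a, b, c i, c (i + 1)},
      ⟨tetrahedron_mem_aroundEdge a b c i, h.card_tetrahedron i, ?_⟩, ?_⟩
    · rcases hx with rfl | rfl <;> grind
    · rcases hx with rfl | rfl <;> grind
    · rintro σ ⟨hσ, hσc, hsub⟩
      obtain ⟨j, rfl⟩ := h.eq_tetrahedron hσ hσc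
      have h1 := (h.mem_tetrahedron_iff i j).1 (hsub (by simp))
      have h2 := (h.mem_tetrahedron_iff (i + 1) j).1 (hsub (by simp))
      have : i = j := by
        rcases h1 with h1 | h1
        · exact h1
        · rcases h2 with h2 | h2
          · exact absurd (by rw [h2, ← h1]) (zmod_succ_succ_ne h.three_le i)
          · exact add_right_cancel h2
      rw [this]

theorem triangle_mem_boundary {x : V} (hx : x = a ∨ x = b) (i : ZMod k) :
    ({x, c i, c (i + 1)} : Finset V) ∈ (aroundEdge a b c).boundary.faces :=
  h.mem_faces_boundary_iff.2 ⟨Finset.insert_nonempty _ _, x, hx, i, subset_rfl⟩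

theorem eq_triangle {t : Finset V} (ht : t ∈ (aroundEdge a b c).boundary.faces)
    (hc : t.card = 3) : ∃ x, (x = a ∨ x = b) ∧ ∃ i, t = {x, c i, c (i + 1)} := by
  obtain ⟨-, x, hx, i, hi⟩ := h.mem_faces_boundary_iff.1 ht
  exact ⟨x, hx, i, Finset.eq_of_subset_of_card_le hi (by rw [h.card_triangle hx, hc])⟩

theorem vertexSet_boundary : (aroundEdge a b c).boundary.vertexSet = Set.univ := by
  refine Set.eq_univ_of_forall fun v => h.mem_faces_boundary_iff.2
    ⟨Finset.singleton_nonempty v, ?_⟩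
  rcases h.exhaust v with rfl | rfl | ⟨i, rfl⟩
  · exact ⟨_, Or.inl rfl, 0, by simp⟩
  · exact ⟨_, Or.inr rfl, 0, by simp⟩
  · exact ⟨_, Or.inl rfl, i, by simp⟩

theorem two_facets {σ : Finset V} (hσ : σ ∈ (aroundEdge a b c).faces) (hc : σ.card = 4) :
    2 ≤ {τ : Finset V | τ ∈ (aroundEdge a b c).boundary.faces ∧ τ.card = 3 ∧ τ ⊆ σ}.ncard := by
  obtain ⟨i, rfl⟩ := h.eq_tetrahedron hσ hc
  have hfin : {τ : Finset V | τ ∈ (aroundEdge a b c).boundary.faces ∧ τ.card = 3 ∧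
      τ ⊆ {a, b, c i, c (i + 1)}}.Finite :=
    (Finset.finite_toSet (Finset.powerset {a, b, c i, c (i + 1)})).subset fun τ hτ =>
      Finset.mem_coe.2 (Finset.mem_powerset.2 hτ.2.2)
  refine (Set.one_lt_ncard hfin).2 ⟨_, ⟨h.triangle_mem_boundary (Or.inl rfl) i,
    h.card_triangle (Or.inl rfl) i, by grind⟩, _, ⟨h.triangle_mem_boundary (Or.inr rfl) i,
    h.card_triangle (Or.inr rfl) i, by grind⟩, fun e => ?_⟩
  have : a ∈ ({b, c i, c (i + 1)} : Finset V) := e ▸ Finset.mem_insert_self _ _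
  simp [h.ne, (h.ne_left _).symm] at this

theorem isThreeDimensional : (aroundEdge a b c).IsThreeDimensional := by
  refine ⟨⟨_, tetrahedron_mem_aroundEdge a b c 0, h.card_tetrahedron 0⟩, ?_⟩
  rintro s ⟨-, i, hi⟩
  exact (Finset.card_le_card hi).trans (h.card_tetrahedron i).le

theorem not_appearsAsLink_boundary [Finite V] :
    ¬ AppearsAsLinkInThreeWellCenteredMesh (aroundEdge a b c).boundary := by
  refine not_appearsAsLinkInThreeWellCenteredMesh b
    ⟨_, h.triangle_mem_boundary (Or.inl rfl) 0, h.card_triangle (Or.inl rfl) 0⟩ ?_ ?_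
  · intro t ht htc j hj
    obtain ⟨x, hx, i, rfl⟩ := h.eq_triangle ht htc
    have hxc : ∀ i, c i ≠ x := fun i => by
      rcases hx with rfl | rfl
      · exact h.ne_left i
      · exact h.ne_right i
    rw [Finset.mem_insert, Finset.mem_insert, Finset.mem_singleton] at hj
    rcases hj with rfl | rfl | rfl
    -- Crossing the edge opposite the apex swaps apexes; crossing the other two edges turns to the
    -- next or the previous triangle at the same apex.
    · obtain ⟨y, hy, hyx⟩ : ∃ y, (y = a ∨ y = b) ∧ y ≠ j := by
        rcases hx with rfl | rfl
        · exact ⟨b, Or.inr rfl, h.ne.symm⟩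
        · exact ⟨a, Or.inl rfl, h.ne⟩
      refine ⟨_, h.triangle_mem_boundary hy i, h.card_triangle hy i, fun e => ?_, by grind⟩
      have : j ∈ ({y, c i, c (i + 1)} : Finset V) := e ▸ Finset.mem_insert_self _ _
      simp [hyx.symm, (hxc _).symm] at this
    · refine ⟨_, h.triangle_mem_boundary hx (i + 1), h.card_triangle hx (i + 1), fun e => ?_,
        by grind⟩
      have : c i ∈ ({x, c (i + 1), c (i + 1 + 1)} : Finset V) := by rw [e]; simp
      simp [hxc, h.injective.eq_iff, (zmod_succ_ne h.three_le i).symm,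
        (zmod_succ_succ_ne h.three_le i).symm] at this
    · refine ⟨_, h.triangle_mem_boundary hx (i - 1), h.card_triangle hx (i - 1), fun e => ?_, ?_⟩
      · have : c (i + 1) ∈ ({x, c (i - 1), c (i - 1 + 1)} : Finset V) := by rw [e]; simp
        have h2 := zmod_succ_succ_ne h.three_le (i - 1)
        rw [sub_add_cancel] at h2
        simp [hxc, h.injective.eq_iff, zmod_succ_ne h.three_le i, h2] at this
      · rw [sub_add_cancel]; grind
  · intro t ht htc hbt
    obtain ⟨x, hx, i, rfl⟩ := h.eq_triangle ht htc
    -- A triangle avoiding `b` has apex `a`, and its ring edge joined with `b` is again a triangle.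
    refine ⟨c i, c (i + 1), x, by grind, ?_⟩
    have := h.triangle_mem_boundary (Or.inr rfl) i
    rwa [show ({c i, c (i + 1), b} : Finset V) = {b, c i, c (i + 1)} by grind]

end IsEdgeRingLabelling

end PreAbstractSimplicialComplex

end Bipyramid

/-! ### Degrees, and the double cone as geometric realization. -/

section BipyramidRealization

namespace PreAbstractSimplicialComplex

theorem vertexDegree_eq_ncard_neighbors {V : Type*} [DecidableEq V]
    (K : PreAbstractSimplicialComplex V) (v : V) :
    K.vertexDegree v = {w | w ≠ v ∧ ({v, w} : Finset V) ∈ K.faces}.ncard := by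
  have himage : {e : Finset V | e ∈ K.faces ∧ e.card = 2 ∧ v ∈ e} =
      (fun w => {v, w}) '' {w | w ≠ v ∧ ({v, w} : Finset V) ∈ K.faces} := by
    ext e
    constructor
    · rintro ⟨he, hc, hv⟩
      obtain ⟨x, y, hxy, rfl⟩ := Finset.card_eq_two.1 hc
      rcases Finset.mem_insert.1 hv with rfl | hv
      · exact ⟨y, ⟨hxy.symm, he⟩, rfl⟩
      · obtain rfl := Finset.mem_singleton.1 hv
        exact ⟨x, ⟨hxy, by rwa [Finset.pair_comm]⟩, Finset.pair_comm _ _⟩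
    · rintro ⟨w, ⟨hw, hf⟩, rfl⟩
      exact ⟨hf, Finset.card_pair hw.symm, Finset.mem_insert_self _ _⟩
  rw [vertexDegree, himage, Set.InjOn.ncard_image]
  rintro w ⟨hw, -⟩ w' - hww'
  have hpair : ({v, w} : Finset V) = {v, w'} := hww'
  have : w ∈ ({v, w'} : Finset V) := hpair ▸ by simp
  simpa [hw] using this

namespace IsEdgeRingLabelling

variable {V : Type*} [DecidableEq V] {k : ℕ} {a b : V} {c : ZMod k → V}
  (h : IsEdgeRingLabelling a b c)

include h

theorem vertexDegree_apex {x : V} (hx : x = a ∨ x = b) :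
    (aroundEdge a b c).boundary.vertexDegree x = k := by
  have hxc : ∀ i, c i ≠ x := fun i => by
    rcases hx with rfl | rfl
    · exact h.ne_left i
    · exact h.ne_right i
  have hset : {w | w ≠ x ∧ ({x, w} : Finset V) ∈ (aroundEdge a b c).boundary.faces} =
      Set.range c := by
    ext w
    constructor
    · rintro ⟨hw, hf⟩
      obtain ⟨-, y, hy, i, hi⟩ := h.mem_faces_boundary_iff.1 hf
      have h1 := hi (Finset.mem_insert_self x {w})
      have h2 := hi (Finset.mem_insert_of_mem (Finset.mem_singleton_self w))
      simp only [Finset.mem_insert, Finset.mem_singleton, (hxc _).symm, or_false] at h1 h2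
      rcases h2 with h2 | h2 | h2
      · exact absurd (h2.trans h1.symm) hw
      · exact ⟨_, h2.symm⟩
      · exact ⟨_, h2.symm⟩
    · rintro ⟨i, rfl⟩
      exact ⟨hxc i, h.mem_faces_boundary_iff.2 ⟨Finset.insert_nonempty _ _, x, hx, i, by grind⟩⟩
  rw [vertexDegree_eq_ncard_neighbors, hset, ← Set.image_univ,
    Set.ncard_image_of_injective _ h.injective, Set.ncard_univ, Nat.card_zmod]

theorem vertexDegree_ring (i : ZMod k) : (aroundEdge a b c).boundary.vertexDegree (c i) = 4 := by
  have hset : {w | w ≠ c i ∧ ({c i, w} : Finset V) ∈ (aroundEdge a b c).boundary.faces} =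
      (({a, b, c (i - 1), c (i + 1)} : Finset V) : Set V) := by
    ext w
    rw [Finset.mem_coe, Set.mem_ofPred_eq, h.mem_faces_boundary_iff]
    constructor
    · rintro ⟨hw, -, x, hx, j, hj⟩
      have h1 := hj (Finset.mem_insert_self (c i) {w})
      have h2 := hj (Finset.mem_insert_of_mem (Finset.mem_singleton_self w))
      have hxc : c i ≠ x := by
        rcases hx with rfl | rfl
        · exact h.ne_left i
        · exact h.ne_right i
      simp only [Finset.mem_insert, Finset.mem_singleton, hxc, h.injective.eq_iff, false_or] at h1
      rcases h1 with rfl | rfl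
      · grind
      · rw [add_sub_cancel_right]; grind
    · intro hw
      rw [Finset.mem_insert, Finset.mem_insert, Finset.mem_insert, Finset.mem_singleton] at hw
      rcases hw with rfl | rfl | rfl | rfl
      · exact ⟨(h.ne_left i).symm, Finset.insert_nonempty _ _, _, Or.inl rfl, i, by grind⟩
      · exact ⟨(h.ne_right i).symm, Finset.insert_nonempty _ _, _, Or.inr rfl, i, by grind⟩
      · refine ⟨fun e => zmod_succ_ne h.three_le (i - 1) ?_, Finset.insert_nonempty _ _, _,
          Or.inl rfl, i - 1, ?_⟩
        · rw [sub_add_cancel]; exact (h.injective e).symm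
        · rw [sub_add_cancel]; grind
      · exact ⟨(h.ring_ne i).symm, Finset.insert_nonempty _ _, _, Or.inl rfl, i, by grind⟩
  have h0 := h.ne
  have h1 := h.ne_left (i - 1)
  have h2 := h.ne_left (i + 1)
  have h3 := h.ne_right (i - 1)
  have h4 := h.ne_right (i + 1)
  -- For `k = 3` the two neighbours on the ring are adjacent but still distinct, so the degree is
  -- `4` there as well.
  have h5 : c (i - 1) ≠ c (i + 1) := fun e => zmod_succ_succ_ne h.three_le (i - 1) (by
    rw [sub_add_cancel]; exact (h.injective e).symm)
  rw [vertexDegree_eq_ncard_neighbors, hset, Set.ncard_coe_finset, Finset.card_insert_of_notMem,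
    Finset.card_insert_of_notMem, Finset.card_pair] <;> grind

theorem notMem_left [NeZero k] : a ∉ insert b (Finset.univ.image c) := by
  simp [h.ne, h.ne_left]

theorem notMem_right [NeZero k] : b ∉ Finset.univ.image c := by
  simp [h.ne_right]

variable [Fintype V]

theorem univ_eq [NeZero k] :
    (Finset.univ : Finset V) = insert a (insert b (Finset.univ.image c)) := by
  ext v
  have := h.exhaust v
  simp only [Finset.mem_univ, Finset.mem_insert, Finset.mem_image, true_and, true_iff]
  grind

theorem degreeList_boundary [NeZero k] :
    (aroundEdge a b c).boundary.degreeList = {k, k} + Multiset.replicate k 4 := by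
  have hall : ∀ v, v ∈ (aroundEdge a b c).boundary.vertexSet := fun v => by
    rw [h.vertexSet_boundary]; trivial
  classical
  rw [degreeList, Finset.filter_true_of_mem fun v _ => hall v, h.univ_eq,
    Finset.insert_val_of_notMem h.notMem_left, Finset.insert_val_of_notMem h.notMem_right,
    Finset.image_val_of_injOn h.injective.injOn, Multiset.map_cons, Multiset.map_cons,
    h.vertexDegree_apex (Or.inl rfl), h.vertexDegree_apex (Or.inr rfl), Multiset.map_map]
  have : Multiset.map ((aroundEdge a b c).boundary.vertexDegree ∘ c) Finset.univ.val =
      Multiset.replicate k 4 := by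
    rw [show (aroundEdge a b c).boundary.vertexDegree ∘ c = Function.const _ 4 from
      funext h.vertexDegree_ring, Multiset.map_const, Finset.card_val, Finset.card_univ, ZMod.card]
  rw [this]
  simp [Multiset.insert_eq_cons]

theorem sum_eq [NeZero k] (g : V → ℝ) : ∑ v, g v = g a + (g b + ∑ i, g (c i)) := by
  rw [h.univ_eq, Finset.sum_insert h.notMem_left, Finset.sum_insert h.notMem_right,
    Finset.sum_image h.injective.injOn]

/-- Every tetrahedron contains `a` and `b`, so the support condition concerns the ring coordinates
alone. -/
theorem mem_realization_iff {x : V → ℝ} : x ∈ (aroundEdge a b c).realization ↔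
    (∀ v, 0 ≤ x v) ∧ ∑ v, x v = 1 ∧ ∃ i, ∀ j, j ≠ i → j ≠ i + 1 → x (c j) = 0 := by
  refine and_congr Iff.rfl (and_congr Iff.rfl ?_)
  constructor
  · rintro ⟨s, ⟨-, i, hi⟩, hs⟩
    refine ⟨i, fun j hj hj' => hs _ fun hmem => ?_⟩
    have := (h.mem_tetrahedron_iff j i).1 (hi hmem)
    tauto
  · rintro ⟨i, hi⟩
    refine ⟨_, tetrahedron_mem_aroundEdge a b c i, fun v hv => ?_⟩
    rcases h.exhaust v with rfl | rfl | ⟨j, rfl⟩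
    · simp at hv
    · simp at hv
    · rw [h.mem_tetrahedron_iff, not_or] at hv
      exact hi j hv.1 hv.2

theorem mem_realization_boundary_iff {x : V → ℝ} :
    x ∈ (aroundEdge a b c).boundary.realization ↔
      x ∈ (aroundEdge a b c).realization ∧ (x a = 0 ∨ x b = 0) := by
  rw [h.mem_realization_iff]
  constructor
  · rintro ⟨h1, h2, s, hs, h3⟩
    obtain ⟨-, y, hy, i, hi⟩ := h.mem_faces_boundary_iff.1 hs
    have hyc : ∀ i, c i ≠ y := fun i => by
      rcases hy with rfl | rfl
      · exact h.ne_left i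
      · exact h.ne_right i
    refine ⟨⟨h1, h2, i, fun j hj hj' => h3 _ fun hmem => ?_⟩, ?_⟩
    · have := hi hmem
      simp only [Finset.mem_insert, Finset.mem_singleton, h.injective.eq_iff] at this
      have := hyc j
      tauto
    · rcases hy with rfl | rfl
      · exact Or.inr (h3 _ fun hmem => by simpa [h.ne.symm, (h.ne_right _).symm] using hi hmem)
      · exact Or.inl (h3 _ fun hmem => by simpa [h.ne, (h.ne_left _).symm] using hi hmem)
  · rintro ⟨⟨h1, h2, i, hi⟩, h0⟩
    obtain ⟨y, hy, h3⟩ : ∃ y, (y = a ∨ y = b) ∧ ∀ v, v ∉ ({y, c i, c (i + 1)} : Finset V) →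
        (v = a ∨ v = b) → x v = 0 := by
      rcases h0 with h0 | h0
      · refine ⟨b, Or.inr rfl, ?_⟩; rintro v hv (rfl | rfl)
        · exact h0
        · simp at hv
      · refine ⟨a, Or.inl rfl, ?_⟩; rintro v hv (rfl | rfl)
        · simp at hv
        · exact h0
    refine ⟨h1, h2, _, h.triangle_mem_boundary hy i, fun v hv => ?_⟩
    rcases h.exhaust v with hv' | hv' | ⟨j, rfl⟩
    · exact h3 v hv (Or.inl hv')
    · exact h3 v hv (Or.inr hv')
    · simp only [Finset.mem_insert, Finset.mem_singleton, h.injective.eq_iff, not_or] at hv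
      exact hi j hv.2.1 hv.2.2

end IsEdgeRingLabelling

section

variable {V : Type*} [DecidableEq V] {k : ℕ} [NeZero k]

/-- The parametrization of the tetrahedra around the edge `a b` by the double cone
`‖z‖ + |t| ≤ 1`: the coordinate `t` runs along the edge, and `z` around it. -/
noncomputable def doubleConeMap (a b : V) (c : ZMod k → V) (p : WithLp 1 (ℂ × ℝ)) : V → ℝ :=
  ((1 - ‖p.fst‖ + p.snd) / 2) • Pi.single a 1 + ((1 - ‖p.fst‖ - p.snd) / 2) • Pi.single b 1 +
    ∑ i, (‖p.fst‖ * circleHat (circleArg p.fst) i) • Pi.single (c i) 1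

theorem continuous_doubleConeMap (a b : V) (c : ZMod k → V) :
    Continuous (doubleConeMap a b c) := by
  have h1 : Continuous fun p : WithLp 1 (ℂ × ℝ) => p.fst :=
    continuous_fst.comp (WithLp.prod_continuous_ofLp 1 ℂ ℝ)
  have h2 : Continuous fun p : WithLp 1 (ℂ × ℝ) => p.snd :=
    continuous_snd.comp (WithLp.prod_continuous_ofLp 1 ℂ ℝ)
  have h3 : ∀ i : ZMod k, Continuous fun p : WithLp 1 (ℂ × ℝ) =>
      ‖p.fst‖ * circleHat (circleArg p.fst) i := fun i => (continuous_norm_mul_circleHat i).comp h1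
  unfold doubleConeMap
  fun_prop

namespace IsEdgeRingLabelling

variable {a b : V} {c : ZMod k → V} (h : IsEdgeRingLabelling a b c)

include h

theorem doubleConeMap_left (p : WithLp 1 (ℂ × ℝ)) :
    doubleConeMap a b c p a = (1 - ‖p.fst‖ + p.snd) / 2 := by
  simp [doubleConeMap, h.ne, (h.ne_left _).symm, Finset.sum_apply]

theorem doubleConeMap_right (p : WithLp 1 (ℂ × ℝ)) :
    doubleConeMap a b c p b = (1 - ‖p.fst‖ - p.snd) / 2 := by
  simp [doubleConeMap, h.ne.symm, (h.ne_right _).symm, Finset.sum_apply]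

theorem doubleConeMap_ring (p : WithLp 1 (ℂ × ℝ)) (i : ZMod k) :
    doubleConeMap a b c p (c i) = ‖p.fst‖ * circleHat (circleArg p.fst) i := by
  simp [doubleConeMap, h.ne_left, h.ne_right, Finset.sum_apply, Pi.single_apply, h.injective.eq_iff]

theorem sum_doubleConeMap_ring (p : WithLp 1 (ℂ × ℝ)) :
    ∑ i, doubleConeMap a b c p (c i) = ‖p.fst‖ := by
  simp only [h.doubleConeMap_ring]
  rw [← Finset.mul_sum, sum_circleHat h.three_le, mul_one]

/-- The ring coordinates sum to `‖z‖` and, when this is nonzero, their ratios fix the argument; the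
coordinate at `a` then gives `t`. -/
theorem doubleConeMap_injective : Function.Injective (doubleConeMap a b c) := by
  intro p q hpq
  have hn : ‖p.fst‖ = ‖q.fst‖ := by
    rw [← h.sum_doubleConeMap_ring, ← h.sum_doubleConeMap_ring, hpq]
  have h1 := congrFun hpq a
  rw [h.doubleConeMap_left, h.doubleConeMap_left, hn] at h1
  have hs : p.snd = q.snd := by linarith
  have hf : p.fst = q.fst := by
    by_cases h0 : p.fst = 0
    · rw [h0, norm_zero] at hn
      rw [h0, norm_eq_zero.1 hn.symm]
    · refine eq_of_norm_eq_of_circleArg_eq hn (circleHat_injective h.three_le (funext fun i => ?_))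
      have h2 := congrFun hpq (c i)
      rw [h.doubleConeMap_ring, h.doubleConeMap_ring, ← hn] at h2
      exact mul_left_cancel₀ (norm_ne_zero_iff.2 h0) h2
  exact (WithLp.ofLp_injective 1) (Prod.ext hf hs)

variable [Fintype V]

/-- Nonnegativity at `a` and `b` says `|t| ≤ 1 - ‖z‖`; the other conditions hold for every `p`. -/
theorem doubleConeMap_mem_realization_iff (p : WithLp 1 (ℂ × ℝ)) :
    doubleConeMap a b c p ∈ (aroundEdge a b c).realization ↔ ‖p‖ ≤ 1 := by
  rw [h.mem_realization_iff, WithLp.prod_norm_eq_of_L1, Real.norm_eq_abs]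
  constructor
  · rintro ⟨h1, -, -⟩
    have ha := h1 a
    have hb := h1 b
    rw [h.doubleConeMap_left] at ha
    rw [h.doubleConeMap_right] at hb
    rcases abs_cases p.snd with ⟨e, -⟩ | ⟨e, -⟩ <;> rw [e] <;> linarith
  · intro hp
    have h1 := le_abs_self p.snd
    have h2 := neg_le_abs p.snd
    refine ⟨fun v => ?_, ?_, ?_⟩
    · rcases h.exhaust v with rfl | rfl | ⟨i, rfl⟩
      · rw [h.doubleConeMap_left]; linarith
      · rw [h.doubleConeMap_right]; linarith
      · rw [h.doubleConeMap_ring]; exact mul_nonneg (norm_nonneg _) (circleHat_nonneg _ _)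
    · rw [h.sum_eq, h.sum_doubleConeMap_ring, h.doubleConeMap_left, h.doubleConeMap_right]
      ring
    · obtain ⟨i, t, ht0, ht1, hθ⟩ := exists_eq_arcPoint k (circleArg p.fst)
      refine ⟨i, fun j hj hj' => ?_⟩
      rw [h.doubleConeMap_ring, hθ, circleHat_arcPoint_of_ne hj hj' ht0 ht1.le, mul_zero]

theorem exists_doubleConeMap_eq {x : V → ℝ} (hx : x ∈ (aroundEdge a b c).realization) :
    ∃ p, doubleConeMap a b c p = x := by
  obtain ⟨h1, h2, i, hi⟩ := h.mem_realization_iff.1 hx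
  rw [h.sum_eq] at h2
  have hsum := sum_eq_add_of_eq_zero (g := fun j => x (c j)) h.three_le hi
  set r := ∑ j, x (c j) with hr
  obtain ⟨z, hz, hzc⟩ : ∃ z : ℂ, ‖z‖ = r ∧ ∀ j, ‖z‖ * circleHat (circleArg z) j = x (c j) := by
    have hi0 := h1 (c i)
    have hi1 := h1 (c (i + 1))
    rcases (Finset.sum_nonneg fun j _ => h1 (c j) : 0 ≤ r).eq_or_lt with h0 | h0
    · refine ⟨0, by rw [norm_zero, h0], fun j => ?_⟩
      rw [norm_zero, zero_mul]
      by_cases hj : j = i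
      · rw [hj]; linarith
      by_cases hj' : j = i + 1
      · rw [hj']; linarith
      exact (hi j hj hj').symm
    -- The modulus is the total ring mass `r`, and the position on the arc is the share of `r` held
    -- by `c (i + 1)`.
    · obtain ⟨z, hz, hzt⟩ := exists_norm_eq_circleArg_eq h0 (arcPoint i (x (c (i + 1)) / r))
      have ht0 : 0 ≤ x (c (i + 1)) / r := div_nonneg hi1 h0.le
      have ht1 : x (c (i + 1)) / r ≤ 1 := by rw [div_le_one h0]; linarith
      refine ⟨z, hz, fun j => ?_⟩
      rw [hz, hzt]
      by_cases hj : j = i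
      · rw [hj, circleHat_arcPoint_self h.three_le i ht0 ht1, mul_sub, mul_div_cancel₀ _ h0.ne']
        linarith
      by_cases hj' : j = i + 1
      · rw [hj', circleHat_arcPoint_succ h.three_le i ht0 ht1, mul_div_cancel₀ _ h0.ne']
      · rw [circleHat_arcPoint_of_ne hj hj' ht0 ht1, mul_zero, hi j hj hj']
  refine ⟨WithLp.toLp 1 (z, x a - x b), funext fun v => ?_⟩
  rcases h.exhaust v with rfl | rfl | ⟨j, rfl⟩
  · rw [h.doubleConeMap_left]
    simp only [WithLp.toLp_fst, WithLp.toLp_snd]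
    linarith
  · rw [h.doubleConeMap_right]
    simp only [WithLp.toLp_fst, WithLp.toLp_snd]
    linarith
  · rw [h.doubleConeMap_ring]
    exact hzc j

theorem isTriangulationOfS2_boundary_and_isThreeManifoldComplex :
    (aroundEdge a b c).boundary.IsTriangulationOfS2 ∧
      (aroundEdge a b c).IsThreeManifoldComplex := by
  have hdim : Module.finrank ℝ (WithLp 1 (ℂ × ℝ)) = 3 := by
    rw [(WithLp.linearEquiv 1 ℝ (ℂ × ℝ)).finrank_eq, Module.finrank_prod]
    simp
  refine isTriangulationOfS2_and_isThreeManifoldComplex hdim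
    (convex_closedBall (0 : WithLp 1 (ℂ × ℝ)) 1) (isCompact_closedBall _ _) ?_
    (continuous_doubleConeMap a b c).continuousOn h.doubleConeMap_injective.injOn ?_ ?_
  · exact ⟨0, Metric.ball_subset_interior_closedBall (Metric.mem_ball_self one_pos)⟩
  · ext x
    constructor
    · rintro ⟨p, hp, rfl⟩
      exact (h.doubleConeMap_mem_realization_iff p).2 (mem_closedBall_zero_iff.1 hp)
    · intro hx
      obtain ⟨p, rfl⟩ := h.exists_doubleConeMap_eq hx
      exact ⟨p, mem_closedBall_zero_iff.2 ((h.doubleConeMap_mem_realization_iff p).1 hx), rfl⟩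
  -- On the double cone, `a` or `b` has coordinate zero exactly when `‖z‖ + |t| = 1`.
  · have key : ∀ p : WithLp 1 (ℂ × ℝ),
        doubleConeMap a b c p ∈ (aroundEdge a b c).boundary.realization ↔ ‖p‖ = 1 := by
      intro p
      rw [h.mem_realization_boundary_iff, h.doubleConeMap_mem_realization_iff,
        h.doubleConeMap_left, h.doubleConeMap_right, WithLp.prod_norm_eq_of_L1, Real.norm_eq_abs]
      have h1 := le_abs_self p.snd
      have h2 := neg_le_abs p.snd
      constructor
      · rintro ⟨h3, h4 | h4⟩ <;> linarith
      · intro h3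
        refine ⟨h3.le, ?_⟩
        rcases abs_cases p.snd with ⟨e, -⟩ | ⟨e, -⟩ <;> rw [e] at h3
        · right; linarith
        · left; linarith
    rw [frontier_closedBall _ one_ne_zero]
    ext x
    constructor
    · rintro ⟨p, hp, rfl⟩
      exact (key p).2 (mem_sphere_zero_iff_norm.1 hp)
    · intro hx
      obtain ⟨p, rfl⟩ := h.exists_doubleConeMap_eq (h.mem_realization_boundary_iff.1 hx).1
      exact ⟨p, mem_sphere_zero_iff_norm.2 ((key p).1 hx), rfl⟩

theorem isOneRingCertificate :
    (aroundEdge a b c).IsOneRingCertificate (aroundEdge a b c).boundary where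
  dimension := h.isThreeDimensional
  manifold := h.isTriangulationOfS2_boundary_and_isThreeManifoldComplex.2
  boundary_iso := isIsomorphic_refl _
  two_facets := fun _ hσ hc => h.two_facets hσ hc

end IsEdgeRingLabelling

/-- The indices `0` and `1` are taken by the edge, hence the shift by `2` on the ring. -/
theorem isEdgeRingLabelling_fin (hk : 3 ≤ k) :
    IsEdgeRingLabelling (0 : Fin (k + 2)) 1
      (fun i : ZMod k => ⟨i.val + 2, Nat.add_lt_add_right i.val_lt 2⟩) where
  three_le := hk
  ne := by simp
  injective i j hij := ZMod.val_injective k (by simpa using hij)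
  ne_left i := by simp [Fin.ext_iff]
  ne_right i := by simp [Fin.ext_iff]
  exhaust v := by
    obtain ⟨v, hv⟩ := v
    rcases v with _ | _ | v
    · exact Or.inl rfl
    · exact Or.inr (Or.inl (Fin.ext (by simp)))
    · exact Or.inr (Or.inr ⟨(v : ZMod k), Fin.ext (by
      change v + 2 = (v : ZMod k).val + 2
      rw [ZMod.val_natCast_of_lt (by omega)])⟩)

end

end PreAbstractSimplicialComplex

end BipyramidRealization

theorem mainTheorem5 (m : ℕ) (hm : 4 ≤ m) :
    ∃ K L : PreAbstractSimplicialComplex (Fin m),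
      L = K.boundary ∧
      (m = 4 → K.IsSingleTetrahedron) ∧
      (5 ≤ m → K.IsTetrahedraAroundEdge (m - 2) ∧
        L.degreeList = {m - 2, m - 2} + Multiset.replicate (m - 2) 4) ∧
      L.IsTriangulationOfS2 ∧
      L.vertexSet.ncard = m ∧
      K.IsOneRingCertificate L ∧
      ¬ AppearsAsLinkInThreeWellCenteredMesh L := by
  rcases hm.eq_or_lt with rfl | hm
  · have hvert : (⊤ : PreAbstractSimplicialComplex (Fin 4)).boundary.vertexSet = Set.univ :=
      Set.eq_univ_of_forall fun v => PreAbstractSimplicialComplex.mem_faces_boundary_top_iff.2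
        ⟨Finset.singleton_nonempty v, fun e => by simpa using congrArg Finset.card e⟩
    refine ⟨⊤, _, rfl, fun _ => PreAbstractSimplicialComplex.isSingleTetrahedron_top,
      fun h => absurd h (by norm_num),
      PreAbstractSimplicialComplex.isTriangulationOfS2_boundary_top_and_isThreeManifoldComplex_top.1,
      ?_, PreAbstractSimplicialComplex.isOneRingCertificate_top,
      PreAbstractSimplicialComplex.not_appearsAsLink_boundary_top⟩
    rw [hvert, Set.ncard_univ, Nat.card_fin]
  · obtain ⟨k, rfl⟩ := Nat.exists_eq_add_of_le' (show 2 ≤ m by omega)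
    have hk : 3 ≤ k := by omega
    have : NeZero k := ⟨by omega⟩
    have h := PreAbstractSimplicialComplex.isEdgeRingLabelling_fin hk
    refine ⟨_, _, rfl, fun e => absurd e (by omega), fun _ =>
      ⟨h.isTetrahedraAroundEdge, h.degreeList_boundary⟩,
      h.isTriangulationOfS2_boundary_and_isThreeManifoldComplex.1, ?_, h.isOneRingCertificate,
      h.not_appearsAsLink_boundary⟩
    rw [h.vertexSet_boundary, Set.ncard_univ, Nat.card_fin]
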